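/- **Setting.** Let $V=(v_{ij})$ be a symmetric positive definite $2\times2$ matrix, $\mu\in\mathbb R^2$, and let $F$ be a probability distribution on $\mathbb R^2$ with a Lebesgue density of the form $f(x)=\det(V)^{-1/2}\,g\big((x-\mu)^TV^{-1}(x-\mu)\big)$ that is bounded in a neighbourhood of $\mu$. Let $V=U\,\mathrm{diag}(\lambda_1,\lambda_2)\,U^T$ with $U$ orthogonal and $\lambda_1\ge\lambda_2$, and put $a=\sqrt{v_{11}/v_{22}}$, $\rho=v_{12}/\sqrt{v_{11}v_{22}}$ and $V_0=\begin{pmatrix}a&\rho\\ \rho&a^{-1}\end{pmatrix}$. Let $X_1,X_2,\dots$ be i.i.d. with distribution $F$. Let $\hat\mu_n$ be a (measurable) spatial median of $X_1,\dots,X_n$, that is, a minimizer of $m\mapsto\sum_{i=1}^n\|X_i-m\|$. With the spatial sign $s(x)=x/\|x\|$ for $x\ne0$ and $s(0)=0$, let $\hat S_n=\frac1n\sum_{i=1}^n s(X_i-\hat\mu_n)s(X_i-\hat\mu_n)^T$ be the empirical spatial sign covariance matrix. Let $\hat S_n=\hat U_n\,\mathrm{diag}(\hat\delta_1,\hat\delta_2)\,\hat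 U_n^T$ be an eigenvalue decomposition, $\hat V_n=\hat U_n\,\mathrm{diag}(\hat\delta_1/\hat\delta_2,\ \hat\delta_2/\hat\delta_1)\,\hat U_n^T$ and $\hat V_{0,n}=(\hat v_{11}\hat v_{22})^{-1/2}\,\hat V_n$, with entries $\hat v_{0,ij}$ (with any value, say $0$, where a denominator vanishes). **Proposition.** As $n\to\infty$: (1) $\hat V_{0,n}\to V_0$ almost surely. (2) $\sqrt n\,\big\{(\hat v_{0,11},\hat v_{0,12})^T-(a,\rho)^T\big\}\to N_2(0,\;G\,W_S\,G^T)$ in distribution. Here $G\,W_S\,G^T$ is positive semidefinite, with $$W_S=\frac{-\lambda_1\lambda_2+\frac12\sqrt{\lambda_1\lambda_2}\,(\lambda_1+\lambda_2)}{(\lambda_1-\lambda_2)^2}\,(U\otimes U)\begin{pmatrix}1&0&0&-1\\0&1&1&0\\0&1&1&0\\-1&0&0&1\end{pmatrix}(U\otimes U)^T,$$ $$G=\frac{(a^2+1)\sqrt{1-\rho^2}+2a(1-\rho^2)}{\sqrt{1-\rho^2}\,\big(4a^2\rho^2+(a^2-1)^2\big)}\begin{pmatrix}g_{11}&g_{12}&0&0\\g_{21}&g_{22}&0&0\end{pmatrix},$$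 $$\begin{aligned} g_{11}&=(a^2-1)^2\sqrt{1-\rho^2}+2a(a^2+1)\rho^2,\\ g_{12}&=(a^2-1)\,\rho\,\big\{2a\sqrt{1-\rho^2}-a^2-1\big\},\\ g_{21}&=a^{-1}(a^2-1)\,\rho\,\big\{(a^2+1)\sqrt{1-\rho^2}-2a(1-\rho^2)\big\},\\ g_{22}&=2(a^2+1)\rho^2\sqrt{1-\rho^2}+a^{-1}(a^2-1)^2(1-\rho^2). \end{aligned}$$ In the spherical case $\lambda_1=\lambda_2$ (equivalently $a=1$, $\rho=0$), where these expressions read $0/0$, they are replaced by their limits: the scalar factor of $W_S$ is $\frac18$, and $G=\begin{pmatrix}4&0&0&0\\0&4&0&0\end{pmatrix}$. Moreover, let $J$ be the map $(a,\rho)\mapsto(s_{11},s_{12})$, where $(s_{ij})=Q\,\mathrm{diag}(\delta_1,\delta_2)\,Q^T$, $\delta_j=\sqrt{\ell_j}/(\sqrt{\ell_1}+\sqrt{\ell_2})$, for an eigenvalue decomposition $Q\,\mathrm{diag}(\ell_1,\ell_2)\,Q^T$ of $\begin{pmatrix}a&\rho\\ \rho&a^{-1}\end{pmatrix}$. Then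 $J(a,\rho)$ consists of the entries $(1,1)$ and $(1,2)$ of $S(F)=\mathbb E\{s(X_1-\mu)s(X_1-\mu)^T\}$, $J$ is differentiable at $(a,\rho)$, and the first two columns of $G$ form the inverse of its Jacobian matrix there. -/

import Mathlib

open MeasureTheory ProbabilityTheory Filter Topology
open scoped Kronecker

noncomputable section

namespace SSCM

/-- Euclidean space `ℝᵖ`. -/
abbrev Vec (p : ℕ) : Type := EuclideanSpace ℝ (Fin p)

/-! ### Elliptical distributions -/

/-- The elliptical density
`x ↦ det(V)^(-1/2) g((x - μ)ᵀ V⁻¹ (x - μ))` with location `μ`, shape `V` and generator `g`. -/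
def ellipticalDensity {p : ℕ} (μ : Vec p) (V : Matrix (Fin p) (Fin p) ℝ) (g : ℝ → ℝ)
    (x : Vec p) : ℝ :=
  (Real.sqrt V.det)⁻¹ * g ((x - μ).ofLp ⬝ᵥ V⁻¹.mulVec (x - μ).ofLp)

/-- `F` is the continuous elliptical distribution with location `μ`, (symmetric, positive definite)
shape matrix `V` and generator `g : [0, ∞) → [0, ∞)`. -/
structure IsElliptical {p : ℕ} (F : Measure (Vec p)) (μ : Vec p)
    (V : Matrix (Fin p) (Fin p) ℝ) (g : ℝ → ℝ) : Prop where
  posDef : V.PosDef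
  measurable_generator : Measurable g
  generator_nonneg : ∀ t, 0 ≤ t → 0 ≤ g t
  isProbabilityMeasure : IsProbabilityMeasure F
  eq_withDensity :
    F = (volume : Measure (Vec p)).withDensity
      (fun x => ENNReal.ofReal (ellipticalDensity μ V g x))

/-! ### Spatial signs, spatial median, spatial sign covariance matrix -/

/-- The spatial sign `x / ‖x‖` for `x ≠ 0`, and `0` for `x = 0`. -/
def spatialSign {p : ℕ} (x : Vec p) : Vec p := ‖x‖⁻¹ • x

/-- The rank one matrix `s(x) s(x)ᵀ`. -/
def signOuter {p : ℕ} (x : Vec p) : Matrix (Fin p) (Fin p) ℝ :=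
  Matrix.vecMulVec (spatialSign x).ofLp (spatialSign x).ofLp

/-- `m` is a spatial median of the finite sample `x 0, …, x (n - 1)`: it minimizes the sum of the
Euclidean distances to the observations. -/
def IsSpatialMedian {p : ℕ} (n : ℕ) (x : ℕ → Vec p) (m : Vec p) : Prop :=
  ∀ y : Vec p, ∑ i ∈ Finset.range n, ‖x i - m‖ ≤ ∑ i ∈ Finset.range n, ‖x i - y‖

/-- The population spatial sign covariance matrix of `F` with respect to the centre `t`. -/
def sscm {p : ℕ} (F : Measure (Vec p)) (t : Vec p) : Matrix (Fin p) (Fin p) ℝ :=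
  Matrix.of fun i j => ∫ x, signOuter (x - t) i j ∂F

/-- The empirical spatial sign covariance matrix of `x 0, …, x (n - 1)` with respect to the
centre `t`. -/
def empSSCM {p : ℕ} (n : ℕ) (x : ℕ → Vec p) (t : Vec p) : Matrix (Fin p) (Fin p) ℝ :=
  (n : ℝ)⁻¹ • ∑ i ∈ Finset.range n, signOuter (x i - t)

theorem isHermitian_empSSCM {p : ℕ} (n : ℕ) (x : ℕ → Vec p) (t : Vec p) :
    (empSSCM n x t).IsHermitian := by
  ext i j
  simp [empSSCM, signOuter, Matrix.vecMulVec_apply, Matrix.sum_apply, mul_comm]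

/-! ### Shape matrices in dimension two -/

/-- `U diag(d₁, d₂) Uᵀ`, where the columns of the orthogonal matrix `U` are the eigenvectors of the
symmetric matrix `A`, in the order of `hA.eigenvalues`. -/
def withEigenvalues {A : Matrix (Fin 2) (Fin 2) ℝ} (hA : A.IsHermitian) (d : Fin 2 → ℝ) :
    Matrix (Fin 2) (Fin 2) ℝ :=
  (hA.eigenvectorUnitary : Matrix (Fin 2) (Fin 2) ℝ) * Matrix.diagonal d *
    (hA.eigenvectorUnitary : Matrix (Fin 2) (Fin 2) ℝ).transpose

/-- The shape matrix `U diag(δ₁/δ₂, δ₂/δ₁) Uᵀ` reconstructed from `S = U diag(δ₁, δ₂) Uᵀ`.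
It depends neither on the order of the eigenvalues nor on the choice of the eigenvectors. -/
def shapeOfSSCM {S : Matrix (Fin 2) (Fin 2) ℝ} (hS : S.IsHermitian) :
    Matrix (Fin 2) (Fin 2) ℝ :=
  withEigenvalues hS
    ![hS.eigenvalues 0 / hS.eigenvalues 1, hS.eigenvalues 1 / hS.eigenvalues 0]

/-- The matrix `U diag(δ₁, δ₂) Uᵀ` with `δⱼ = √λⱼ / (√λ₁ + √λ₂)`, for `V = U diag(λ₁, λ₂) Uᵀ`. -/
def sscmOfShape {V : Matrix (Fin 2) (Fin 2) ℝ} (hV : V.IsHermitian) :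
    Matrix (Fin 2) (Fin 2) ℝ :=
  withEigenvalues hV fun j =>
    Real.sqrt (hV.eigenvalues j) /
      (Real.sqrt (hV.eigenvalues 0) + Real.sqrt (hV.eigenvalues 1))

/-- Rescaling of a matrix such that the product of its diagonal elements becomes `1`. -/
def diagNormalize (V : Matrix (Fin 2) (Fin 2) ℝ) : Matrix (Fin 2) (Fin 2) ℝ :=
  (Real.sqrt (V 0 0 * V 1 1))⁻¹ • V

/-- The estimator `V̂ₙ`, computed from the observations `x 0, …, x (n - 1)` and the centre `t`. -/
def shapeEst (n : ℕ) (x : ℕ → Vec 2) (t : Vec 2) : Matrix (Fin 2) (Fin 2) ℝ :=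
  shapeOfSSCM (isHermitian_empSSCM n x t)

/-- The estimator `V̂₀,ₙ`, the diagonal-normalized version of `V̂ₙ`. -/
def shapeEst₀ (n : ℕ) (x : ℕ → Vec 2) (t : Vec 2) : Matrix (Fin 2) (Fin 2) ℝ :=
  diagNormalize (shapeEst n x t)

/-- The parameter `a = √(v₁₁ / v₂₂)`. -/
def ratio (V : Matrix (Fin 2) (Fin 2) ℝ) : ℝ := Real.sqrt (V 0 0 / V 1 1)

/-- The generalized correlation coefficient `ρ = v₁₂ / √(v₁₁ v₂₂)`. -/
def corr (V : Matrix (Fin 2) (Fin 2) ℝ) : ℝ := V 0 1 / Real.sqrt (V 0 0 * V 1 1)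

/-- The shape matrix with reciprocal diagonal elements `a`, `a⁻¹` and correlation `ρ`. -/
def shape₀ (a ρ : ℝ) : Matrix (Fin 2) (Fin 2) ℝ := !![a, ρ; ρ, a⁻¹]

theorem isHermitian_shape₀ (a ρ : ℝ) : (shape₀ a ρ).IsHermitian := by
  ext i j
  fin_cases i <;> fin_cases j <;> simp [shape₀]

/-- The map `(a, ρ) ↦ (s₁₁, s₁₂)` from the parameters of the shape matrix to the elements of the
spatial sign covariance matrix. -/
def paramToSSCM (θ : Fin 2 → ℝ) : Fin 2 → ℝ :=
  ![sscmOfShape (isHermitian_shape₀ (θ 0) (θ 1)) 0 0,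
    sscmOfShape (isHermitian_shape₀ (θ 0) (θ 1)) 0 1]

/-! ### The asymptotic covariance matrices -/

/-- The scalar factor of `W_S`. At `l₁ = l₂`, where the formula reads `0 / 0`, it is continued by
its limit `1 / 8`. -/
def wCoeff (l₁ l₂ : ℝ) : ℝ :=
  if l₁ = l₂ then 1 / 8
  else (-(l₁ * l₂) + 1 / 2 * Real.sqrt (l₁ * l₂) * (l₁ + l₂)) / (l₁ - l₂) ^ 2

/-- The matrix `W₀`. -/
def W₀ : Matrix (Fin 4) (Fin 4) ℝ :=
  !![ 1, 0, 0, -1;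
      0, 1, 1,  0;
      0, 1, 1,  0;
     -1, 0, 0,  1]

/-- The Kronecker product `U ⊗ U` as a `4 × 4` matrix, in the usual (lexicographic) order. -/
def kronSq (U : Matrix (Fin 2) (Fin 2) ℝ) : Matrix (Fin 4) (Fin 4) ℝ :=
  Matrix.reindex (finProdFinEquiv (m := 2) (n := 2)) (finProdFinEquiv (m := 2) (n := 2)) (U ⊗ₖ U)

/-- The asymptotic covariance matrix `W_S` of `vec Ŝₙ`, for the shape `U diag(l₁, l₂) Uᵀ`. -/
def WS (U : Matrix (Fin 2) (Fin 2) ℝ) (l₁ l₂ : ℝ) : Matrix (Fin 4) (Fin 4) ℝ :=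
  wCoeff l₁ l₂ • (kronSq U * W₀ * (kronSq U).transpose)

/-- The `2 × 4` matrix `G`. At `a = 1`, `ρ = 0`, where the formula reads `0 / 0`, it is continued by
its limit. -/
def G (a ρ : ℝ) : Matrix (Fin 2) (Fin 4) ℝ :=
  if a = 1 ∧ ρ = 0 then !![4, 0, 0, 0; 0, 4, 0, 0]
  else
    (((a ^ 2 + 1) * Real.sqrt (1 - ρ ^ 2) + 2 * a * (1 - ρ ^ 2)) /
      (Real.sqrt (1 - ρ ^ 2) * (4 * a ^ 2 * ρ ^ 2 + (a ^ 2 - 1) ^ 2))) •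
    !![(a ^ 2 - 1) ^ 2 * Real.sqrt (1 - ρ ^ 2) + 2 * a * (a ^ 2 + 1) * ρ ^ 2,
        (a - 1) * (a + 1) * ρ * (2 * a * Real.sqrt (1 - ρ ^ 2) - a ^ 2 - 1), 0, 0;
       a⁻¹ * (a - 1) * (a + 1) * ρ *
          ((a ^ 2 + 1) * Real.sqrt (1 - ρ ^ 2) - 2 * a * (1 - ρ ^ 2)),
        2 * (a ^ 2 + 1) * ρ ^ 2 * Real.sqrt (1 - ρ ^ 2) +
          a⁻¹ * (a ^ 2 - 1) ^ 2 * (1 - ρ ^ 2), 0, 0]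

/-- The asymptotic covariance matrix `W_{V₀} = G W_S Gᵀ`. -/
def WV₀ (a ρ : ℝ) (U : Matrix (Fin 2) (Fin 2) ℝ) (l₁ l₂ : ℝ) : Matrix (Fin 2) (Fin 2) ℝ :=
  G a ρ * WS U l₁ l₂ * (G a ρ).transpose

end SSCM

end

/-! Identify the plane with `ℂ` and centre at `μ`. The sign matrix of `w` is an affine function of
the doubled-angle direction `dirSq w = w / conj w`, so the spatial sign covariance matrix amounts to
the mean of `dirSq`. Apart from the trace, which falls below one only through observations equal to
the centre, everything is a statement about one complex mean `q`.

Population. In dimension two, the square root of `V` acts as `z ↦ c (z + q₀ conj z)` with `q₀ =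
meanDirSq V`. On the unit circle this turns `dirSq` into `(z² + q₀) / (1 + conj q₀ z²)`, holomorphic
on the closed disc, and the mean value property gives `E dirSq ^ k = q₀ ^ k`
(`integral_dirSq_pow_centredLaw`). The case `k = 1` is the mean. With `k = 2` one gets `E (dirSq -
q₀)² = 0`, so the real and imaginary parts are uncorrelated with common variance `(1 - ‖q₀‖²) / 2`
(`integral_linear_sq`). This is what `W_S` encodes, and `G W_S Gᵀ` becomes `(1 - ‖q₀‖²) / 8` times
`G₂ G₂ᵀ` (`WV₀_eq`).

Estimated centre. A quadratic minorant of the distance function bounds the centred median `t` by a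
constant times the mean direction `avg dir` (`norm_spatialMedian_le`). In the expansion of `dirSq (y
- t)` the linear coefficients `1 / conj y` and `y / conj y²` are odd, so their averages tend to zero
by the strong law; the remainder is of order `‖t‖^(3/2) ‖y‖^(-3/2)`, integrable because the density
is bounded near the centre. Hence using the median instead of `μ` changes the mean of `dirSq` by
`o(‖avg dir‖)` almost surely (`ae_dirSqEst`). Since `avg dir → 0`, consistency follows; since `√n
avg dir` is bounded in probability, the change vanishes after scaling by `√n`.

Delta method. The pair `(a, ρ)` is a smooth function `dirSqToParam` of `q`, read off from the
normalized square of the sign covariance matrix. It inverts `paramToSSCM` up to an affine change of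
coordinates, so its derivative is the inverse of `jacobian`, which is `G₂` (`G₂_mul_jacobian`). -/

noncomputable section

namespace SSCM

open scoped ComplexConjugate

/-! ### Explicit formulas for the shape and sign covariance matrices -/

section Spectral

variable {A : Matrix (Fin 2) (Fin 2) ℝ} (hA : A.IsHermitian)

theorem withEigenvalues_eigenvalues : withEigenvalues hA hA.eigenvalues = A := by
  conv_rhs => rw [hA.spectral_theorem]
  rw [Unitary.conjStarAlgAut_apply, withEigenvalues, Matrix.star_eq_conjTranspose,
    Matrix.conjTranspose_eq_transpose_of_trivial]
  rfl

theorem eigenvectorUnitary_transpose_mul :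
    (hA.eigenvectorUnitary : Matrix (Fin 2) (Fin 2) ℝ).transpose *
      (hA.eigenvectorUnitary : Matrix (Fin 2) (Fin 2) ℝ) = 1 := by
  have := Unitary.coe_star_mul_self hA.eigenvectorUnitary
  rwa [Matrix.star_eq_conjTranspose, Matrix.conjTranspose_eq_transpose_of_trivial] at this

theorem withEigenvalues_mul (d e : Fin 2 → ℝ) :
    withEigenvalues hA d * withEigenvalues hA e = withEigenvalues hA (d * e) := by
  simp only [withEigenvalues, Matrix.mul_assoc]
  rw [← Matrix.mul_assoc (Matrix.transpose _) (hA.eigenvectorUnitary : Matrix (Fin 2) (Fin 2) ℝ),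
    eigenvectorUnitary_transpose_mul, Matrix.one_mul, ← Matrix.mul_assoc (Matrix.diagonal d),
    Matrix.diagonal_mul_diagonal]
  rfl

theorem withEigenvalues_smul (c : ℝ) (d : Fin 2 → ℝ) :
    withEigenvalues hA (c • d) = c • withEigenvalues hA d := by
  simp [withEigenvalues, Matrix.diagonal_smul]

theorem withEigenvalues_add (d e : Fin 2 → ℝ) :
    withEigenvalues hA (d + e) = withEigenvalues hA d + withEigenvalues hA e := by
  simp only [withEigenvalues, ← Matrix.add_mul, ← Matrix.mul_add, Matrix.diagonal_add]
  rfl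

theorem withEigenvalues_one : withEigenvalues hA 1 = 1 := by
  have := Unitary.coe_mul_star_self hA.eigenvectorUnitary
  rw [Unitary.coe_star, Matrix.star_eq_conjTranspose, Matrix.conjTranspose_eq_transpose_of_trivial] at this
  simp [withEigenvalues, this]

theorem eigenvalues_mul_eq_det : hA.eigenvalues 0 * hA.eigenvalues 1 = A.det := by
  simpa using hA.det_eq_prod_eigenvalues.symm

theorem eigenvalues_add_eq_trace : hA.eigenvalues 0 + hA.eigenvalues 1 = A.trace := by
  simpa using hA.trace_eq_sum_eigenvalues.symm

/-- The eigenvalues `δ₁/δ₂`, `δ₂/δ₁` are `δ₁²`, `δ₂²` divided by `δ₁δ₂`. With division by zero equal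
to zero this also holds for singular `A`. The eigenvectors disappear, which makes the estimator
rational in the entries of `A`. -/
theorem shapeOfSSCM_eq : shapeOfSSCM hA = A.det⁻¹ • (A * A) := by
  have h : ![hA.eigenvalues 0 / hA.eigenvalues 1, hA.eigenvalues 1 / hA.eigenvalues 0]
      = A.det⁻¹ • (hA.eigenvalues * hA.eigenvalues) := by
    rw [← eigenvalues_mul_eq_det hA]
    ext i
    fin_cases i
    · by_cases h0 : hA.eigenvalues 0 = 0
      · simp [h0]
      · simp; field_simp
    · by_cases h0 : hA.eigenvalues 1 = 0
      · simp [h0]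
      · simp; field_simp
  rw [shapeOfSSCM, h, withEigenvalues_smul, ← withEigenvalues_mul, withEigenvalues_eigenvalues]

/-- Multiplying numerator and denominator of `√x / (√x + √y)` by `√x + √y` gives `(x + √(xy)) / (x +
y + 2√(xy))`, which is affine in the eigenvalue `x` with coefficients depending only on trace and
determinant. -/
theorem sscmOfShape_eq (hdet : 0 < A.det) (htr : 0 < A.trace) :
    sscmOfShape hA = (A.trace + 2 * √A.det)⁻¹ • (A + √A.det • (1 : Matrix (Fin 2) (Fin 2) ℝ)) := by
  have hd := eigenvalues_mul_eq_det hA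
  have ht := eigenvalues_add_eq_trace hA
  set x := hA.eigenvalues 0 with hx
  set y := hA.eigenvalues 1 with hy
  have hxy : 0 < x ∧ 0 < y := by
    rcases mul_pos_iff.1 (hd ▸ hdet) with h | h
    · exact h
    · linarith [h.1, h.2]
  have key : ∀ a b : ℝ, 0 < a → 0 < b →
      √a / (√a + √b) = (a + b + 2 * √(a * b))⁻¹ * (a + √(a * b)) := by
    intro a b ha hb
    have ha' := Real.sqrt_pos.2 ha
    have hb' := Real.sqrt_pos.2 hb
    rw [Real.sqrt_mul ha.le]
    obtain ⟨s, hs⟩ : ∃ s, s = √a := ⟨_, rfl⟩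
    obtain ⟨t, htt⟩ : ∃ s, s = √b := ⟨_, rfl⟩
    have e1 : a = s ^ 2 := by rw [hs, Real.sq_sqrt ha.le]
    have e2 : b = t ^ 2 := by rw [htt, Real.sq_sqrt hb.le]
    rw [← hs, ← htt] at *
    rw [e1, e2]
    have : s ^ 2 + t ^ 2 + 2 * (s * t) = (s + t) ^ 2 := by ring
    rw [this]
    field_simp
  have h : (fun j => √(hA.eigenvalues j) / (√x + √y))
      = (A.trace + 2 * √A.det)⁻¹ • (hA.eigenvalues + √A.det • 1) := by
    rw [← hd, ← ht]
    ext i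
    fin_cases i
    · simpa [← hx] using key x y hxy.1 hxy.2
    · have := key y x hxy.2 hxy.1
      rw [add_comm (√y), add_comm y, mul_comm y] at this
      simpa [← hy] using this
  rw [sscmOfShape, ← hx, ← hy, h, withEigenvalues_smul, withEigenvalues_add, withEigenvalues_smul,
    withEigenvalues_one, withEigenvalues_eigenvalues]

end Spectral

theorem paramToSSCM_eq {θ : Fin 2 → ℝ} (ha : 0 < θ 0) (hρ : θ 1 ^ 2 < 1) :
    paramToSSCM θ = ![(θ 0 + √(1 - θ 1 ^ 2)) / (θ 0 + (θ 0)⁻¹ + 2 * √(1 - θ 1 ^ 2)),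
      θ 1 / (θ 0 + (θ 0)⁻¹ + 2 * √(1 - θ 1 ^ 2))] := by
  have hdet : (shape₀ (θ 0) (θ 1)).det = 1 - θ 1 ^ 2 := by
    simp [shape₀, Matrix.det_fin_two, ha.ne', sq]
  have htr : (shape₀ (θ 0) (θ 1)).trace = θ 0 + (θ 0)⁻¹ := by
    simp [shape₀, Matrix.trace_fin_two]
  rw [paramToSSCM, sscmOfShape_eq _ (by rw [hdet]; linarith) (by rw [htr]; positivity), hdet, htr]
  simp only [shape₀]
  ext i
  fin_cases i <;> simp <;> ring

/-! ### The Jacobian matrix of `paramToSSCM` -/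

/-- The Jacobian matrix of `paramToSSCM` at `(a, ρ)`. -/
def jacobian (a ρ : ℝ) : Matrix (Fin 2) (Fin 2) ℝ :=
  !![((a + a⁻¹ + 2 * √(1 - ρ ^ 2)) - (a + √(1 - ρ ^ 2)) * (1 - (a ^ 2)⁻¹)) /
        (a + a⁻¹ + 2 * √(1 - ρ ^ 2)) ^ 2,
      (-(ρ / √(1 - ρ ^ 2)) * (a + a⁻¹ + 2 * √(1 - ρ ^ 2)) +
        (a + √(1 - ρ ^ 2)) * (2 * (ρ / √(1 - ρ ^ 2)))) / (a + a⁻¹ + 2 * √(1 - ρ ^ 2)) ^ 2;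
    -(ρ * (1 - (a ^ 2)⁻¹)) / (a + a⁻¹ + 2 * √(1 - ρ ^ 2)) ^ 2,
      ((a + a⁻¹ + 2 * √(1 - ρ ^ 2)) + ρ * (2 * (ρ / √(1 - ρ ^ 2)))) /
        (a + a⁻¹ + 2 * √(1 - ρ ^ 2)) ^ 2]

theorem hasFDerivAt_paramToSSCM {a ρ : ℝ} (ha : 0 < a) (hρ : ρ ^ 2 < 1) :
    HasFDerivAt paramToSSCM
      (LinearMap.toContinuousLinearMap (Matrix.toLin' (jacobian a ρ))) ![a, ρ] := by
  have hr : 0 < √(1 - ρ ^ 2) := Real.sqrt_pos.2 (by linarith)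
  have hN : 0 < a + a⁻¹ + 2 * √(1 - ρ ^ 2) := by positivity
  obtain ⟨θ₀, hθ⟩ : ∃ θ₀ : Fin 2 → ℝ, θ₀ = ![a, ρ] := ⟨_, rfl⟩
  have e0 : θ₀ 0 = a := by simp [hθ]
  have e1 : θ₀ 1 = ρ := by simp [hθ]
  rw [← hθ]
  have h0 : HasFDerivAt (fun θ : Fin 2 → ℝ => θ 0)
      (ContinuousLinearMap.proj (R := ℝ) (φ := fun _ : Fin 2 => ℝ) 0) θ₀ :=
    (ContinuousLinearMap.proj (R := ℝ) (φ := fun _ : Fin 2 => ℝ) 0).hasFDerivAt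
  have h1 : HasFDerivAt (fun θ : Fin 2 → ℝ => θ 1)
      (ContinuousLinearMap.proj (R := ℝ) (φ := fun _ : Fin 2 => ℝ) 1) θ₀ :=
    (ContinuousLinearMap.proj (R := ℝ) (φ := fun _ : Fin 2 => ℝ) 1).hasFDerivAt
  have hs : HasFDerivAt (fun θ : Fin 2 → ℝ => √(1 - θ 1 ^ 2)) _ θ₀ :=
    ((h1.pow 2).const_sub 1).sqrt (by rw [e1]; linarith)
  have hi : HasFDerivAt (fun θ : Fin 2 → ℝ => (θ 0)⁻¹) _ θ₀ :=
    (hasDerivAt_inv (x := θ₀ 0) (by rw [e0]; exact ha.ne')).comp_hasFDerivAt θ₀ h0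
  have hD : HasFDerivAt (fun θ : Fin 2 → ℝ => θ 0 + (θ 0)⁻¹ + 2 * √(1 - θ 1 ^ 2)) _ θ₀ :=
    (h0.add hi).add (hs.const_mul 2)
  have hDi : HasFDerivAt (fun θ : Fin 2 → ℝ => (θ 0 + (θ 0)⁻¹ + 2 * √(1 - θ 1 ^ 2))⁻¹) _ θ₀ :=
    (hasDerivAt_inv (x := θ₀ 0 + (θ₀ 0)⁻¹ + 2 * √(1 - θ₀ 1 ^ 2))
      (by rw [e0, e1]; exact hN.ne')).comp_hasFDerivAt θ₀ hD
  -- The closed formula is available only for `a > 0` and `ρ² < 1`; this set is open, so it suffices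
  -- for the derivative.
  have heq : paramToSSCM =ᶠ[𝓝 θ₀] fun θ =>
      ![(θ 0 + √(1 - θ 1 ^ 2)) * (θ 0 + (θ 0)⁻¹ + 2 * √(1 - θ 1 ^ 2))⁻¹,
        θ 1 * (θ 0 + (θ 0)⁻¹ + 2 * √(1 - θ 1 ^ 2))⁻¹] := by
    have c0 : ∀ᶠ θ : Fin 2 → ℝ in 𝓝 θ₀, 0 < θ 0 :=
      (continuous_apply 0).continuousAt.eventually (lt_mem_nhds (by simpa [e0] using ha))
    have c1 : ∀ᶠ θ : Fin 2 → ℝ in 𝓝 θ₀, θ 1 ^ 2 < 1 :=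
      ((continuous_apply 1).pow 2).continuousAt.eventually (gt_mem_nhds (by simpa [e1] using hρ))
    filter_upwards [c0, c1] with θ h0 h1
    rw [paramToSSCM_eq h0 h1, div_eq_mul_inv, div_eq_mul_inv]
  refine HasFDerivAt.congr_of_eventuallyEq ?_ heq
  rw [hasFDerivAt_pi']
  intro i
  fin_cases i
  · refine ((h0.add hs).mul hDi).congr_fderiv ?_
    ext v
    simp [jacobian, e0, e1, dotProduct, Fin.sum_univ_two]
    field_simp
    ring
  · refine (h1.mul hDi).congr_fderiv ?_
    ext v
    simp [jacobian, e0, e1, dotProduct, Fin.sum_univ_two]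
    field_simp
    ring

/-- The first two columns of `G`. -/
def G₂ (a ρ : ℝ) : Matrix (Fin 2) (Fin 2) ℝ :=
  (G a ρ).submatrix id (Fin.castLE (by norm_num : 2 ≤ 4))

/-- At the spherical point this is a numerical check of the continued value of `G`. Elsewhere, with
`r = √(1 - ρ²)`, it is an identity of rational functions in `a`, `ρ`, `r` modulo `ρ² = 1 - r²`. -/
theorem G₂_mul_jacobian {a ρ : ℝ} (ha : 0 < a) (hρ : ρ ^ 2 < 1) :
    G₂ a ρ * jacobian a ρ = 1 := by
  by_cases h : a = 1 ∧ ρ = 0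
  · obtain ⟨rfl, rfl⟩ := h
    ext i j
    fin_cases i <;> fin_cases j <;>
      simp [G₂, G, jacobian, Matrix.mul_apply, Fin.sum_univ_two, Fin.castLE] <;> norm_num
  · have hr : 0 < √(1 - ρ ^ 2) := Real.sqrt_pos.2 (by linarith)
    have hr2 : √(1 - ρ ^ 2) ^ 2 = 1 - ρ ^ 2 := Real.sq_sqrt (by linarith)
    -- For `a > 0` this denominator vanishes only at `a = 1`, `ρ = 0`.
    have hden : 0 < 4 * a ^ 2 * ρ ^ 2 + (a ^ 2 - 1) ^ 2 := by
      by_cases hρ0 : ρ = 0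
      · have : a ^ 2 - 1 ≠ 0 := fun h' => h ⟨by nlinarith, hρ0⟩
        positivity
      · positivity
    have hN : 0 < a ^ 2 + 1 + 2 * a * √(1 - ρ ^ 2) := by positivity
    simp only [G₂, G, h, if_false, jacobian]
    generalize √(1 - ρ ^ 2) = r at *
    have hρ2 : ρ ^ 2 = 1 - r ^ 2 := by linarith
    have e1 : a + a⁻¹ + 2 * r = (a ^ 2 + 1 + 2 * a * r) / a := by field_simp
    rw [e1]
    obtain ⟨N, hNe⟩ : ∃ N, N = a ^ 2 + 1 + 2 * a * r := ⟨_, rfl⟩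
    obtain ⟨Δ, hΔ⟩ : ∃ Δ, Δ = 4 * a ^ 2 * ρ ^ 2 + (a ^ 2 - 1) ^ 2 := ⟨_, rfl⟩
    rw [← hNe] at hN ⊢
    rw [← hΔ] at hden ⊢
    rw [hρ2] at hΔ
    clear e1 h hr2 hρ
    ext i j
    fin_cases i <;> fin_cases j <;>
      simp [Matrix.mul_apply, Fin.sum_univ_two, Fin.castLE] <;> field_simp <;>
      (try simp only [hρ2]) <;> rw [hNe] <;> (try rw [hΔ]) <;> ring

/-! ### Positive definite shape matrices -/

section PosDef

variable {V : Matrix (Fin 2) (Fin 2) ℝ}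

theorem symm_of_posDef (hV : V.PosDef) : V 1 0 = V 0 1 := by
  simpa using hV.1.apply 0 1

theorem diag_pos_of_posDef (hV : V.PosDef) (i : Fin 2) : 0 < V i i := hV.diag_pos

theorem det_eq_of_posDef (hV : V.PosDef) : V.det = V 0 0 * V 1 1 - V 0 1 ^ 2 := by
  rw [Matrix.det_fin_two, symm_of_posDef hV, sq]

theorem ratio_pos (hV : V.PosDef) : 0 < ratio V :=
  Real.sqrt_pos.2 (div_pos (diag_pos_of_posDef hV 0) (diag_pos_of_posDef hV 1))

theorem one_sub_corr_sq (hV : V.PosDef) : 1 - corr V ^ 2 = V.det / (V 0 0 * V 1 1) := by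
  have h0 := diag_pos_of_posDef hV 0
  have h1 := diag_pos_of_posDef hV 1
  rw [corr, div_pow, Real.sq_sqrt (by positivity), det_eq_of_posDef hV]
  field_simp

theorem corr_sq_lt_one (hV : V.PosDef) : corr V ^ 2 < 1 := by
  have h0 := diag_pos_of_posDef hV 0
  have h1 := diag_pos_of_posDef hV 1
  have : 0 < 1 - corr V ^ 2 := by
    rw [one_sub_corr_sq hV]; exact div_pos hV.det_pos (by positivity)
  linarith

/-- The mean of the doubled-angle direction `w / conj w` under an elliptical distribution with
shape `V`, that is, `s₁₁ - s₂₂ + 2 i s₁₂` for the spatial sign covariance matrix `s`. -/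
def meanDirSq (V : Matrix (Fin 2) (Fin 2) ℝ) : ℂ :=
  ⟨(V 0 0 - V 1 1) / (V 0 0 + V 1 1 + 2 * √V.det), 2 * V 0 1 / (V 0 0 + V 1 1 + 2 * √V.det)⟩

theorem trace_add_pos (hV : V.PosDef) : 0 < V 0 0 + V 1 1 + 2 * √V.det := by
  have h0 := diag_pos_of_posDef hV 0
  have h1 := diag_pos_of_posDef hV 1
  positivity

/-- In eigenvalues of `V` this is `4√(λ₁λ₂) / (√λ₁ + √λ₂)²`. It shows that `meanDirSq V` lies inside
the unit disc, and it is the variance factor of the limit law. -/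
theorem one_sub_norm_meanDirSq_sq (hV : V.PosDef) :
    1 - ‖meanDirSq V‖ ^ 2 = 4 * √V.det / (V 0 0 + V 1 1 + 2 * √V.det) := by
  have hN := trace_add_pos hV
  have hr : √V.det ^ 2 = V 0 0 * V 1 1 - V 0 1 ^ 2 := by
    rw [Real.sq_sqrt hV.det_pos.le, det_eq_of_posDef hV]
  rw [← Complex.normSq_eq_norm_sq, Complex.normSq_apply, meanDirSq]
  generalize √V.det = r at *
  field_simp
  linear_combination (-4) * hr

theorem norm_meanDirSq_lt_one (hV : V.PosDef) : ‖meanDirSq V‖ < 1 := by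
  have h := one_sub_norm_meanDirSq_sq hV
  have : 0 < 4 * √V.det / (V 0 0 + V 1 1 + 2 * √V.det) :=
    div_pos (mul_pos four_pos (Real.sqrt_pos.2 hV.det_pos)) (trace_add_pos hV)
  nlinarith [norm_nonneg (meanDirSq V)]

/-- `shape₀ (ratio V) (corr V)` is `V` divided by `√(v₁₁ v₂₂)`, and the sign covariance matrix does
not change under rescaling of the shape. -/
theorem paramToSSCM_ratio_corr (hV : V.PosDef) :
    paramToSSCM ![ratio V, corr V] = ![(1 + (meanDirSq V).re) / 2, (meanDirSq V).im / 2] := by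
  rw [paramToSSCM_eq (by simpa using ratio_pos hV) (by simpa using corr_sq_lt_one hV)]
  have h0 := diag_pos_of_posDef hV 0
  have h1 := diag_pos_of_posDef hV 1
  have hN := trace_add_pos hV
  have hs : √(1 - corr V ^ 2) = √V.det / (√(V 0 0) * √(V 1 1)) := by
    rw [one_sub_corr_sq hV, Real.sqrt_div hV.det_pos.le, Real.sqrt_mul h0.le]
  have hc : corr V = V 0 1 / (√(V 0 0) * √(V 1 1)) := by rw [corr, Real.sqrt_mul h0.le]
  have ha : ratio V = √(V 0 0) / √(V 1 1) := by rw [ratio, Real.sqrt_div h0.le]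
  have p0 := Real.sqrt_pos.2 h0
  have p1 := Real.sqrt_pos.2 h1
  have e0 := Real.sq_sqrt h0.le
  have e1 := Real.sq_sqrt h1.le
  have hden : √(V 0 0) / √(V 1 1) + (√(V 0 0) / √(V 1 1))⁻¹ + 2 * (√V.det / (√(V 0 0) * √(V 1 1)))
      = (V 0 0 + V 1 1 + 2 * √V.det) / (√(V 0 0) * √(V 1 1)) := by
    field_simp
    rw [e0, e1]
  simp only [Matrix.cons_val_zero, Matrix.cons_val_one, hs]
  rw [ha, hden, hc]
  simp only [meanDirSq]
  ext i
  fin_cases i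
  · simp
    field_simp
    rw [e0]; ring
  · simp
    field_simp

end PosDef

/-! ### The asymptotic covariance matrix -/

section Covariance

theorem G_eq (a ρ : ℝ) : G a ρ = G₂ a ρ * (!![1, 0, 0, 0; 0, 1, 0, 0] : Matrix (Fin 2) (Fin 4) ℝ) := by
  by_cases h : a = 1 ∧ ρ = 0 <;> ext i j <;> fin_cases i <;> fin_cases j <;>
    simp [G₂, G, h, Matrix.mul_apply, Fin.sum_univ_two, Fin.castLE]

/-- `W₀` is twice the orthogonal projection onto the vectorized traceless symmetric matrices, a
subspace invariant under `U ⊗ U`. Conjugation therefore leaves `W₀` unchanged, and the upper left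
block of `W₀` is the identity. Since the last two columns of `G` vanish, only this block matters. -/
theorem kronSq_conj_W₀_block {U : Matrix (Fin 2) (Fin 2) ℝ}
    (hU : U ∈ Matrix.orthogonalGroup (Fin 2) ℝ) :
    (!![1, 0, 0, 0; 0, 1, 0, 0] : Matrix (Fin 2) (Fin 4) ℝ) *
      (kronSq U * W₀ * (kronSq U).transpose) *
      (!![1, 0, 0, 0; 0, 1, 0, 0] : Matrix (Fin 2) (Fin 4) ℝ).transpose = 1 := by
  have h := (Matrix.mem_orthogonalGroup_iff (Fin 2) ℝ).1 hU
  have h00 := congrFun (congrFun h 0) 0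
  have h01 := congrFun (congrFun h 0) 1
  have h11 := congrFun (congrFun h 1) 1
  simp [Matrix.mul_apply, Fin.sum_univ_two] at h00 h01 h11
  have hE : ∀ M : Matrix (Fin 4) (Fin 4) ℝ, (!![1, 0, 0, 0; 0, 1, 0, 0] : Matrix (Fin 2) (Fin 4) ℝ) *
      M * (!![1, 0, 0, 0; 0, 1, 0, 0] : Matrix (Fin 2) (Fin 4) ℝ).transpose =
      !![M 0 0, M 0 1; M 1 0, M 1 1] := by
    intro M
    ext i j
    simp only [Matrix.mul_apply, Fin.sum_univ_four]
    fin_cases i <;> fin_cases j <;> simp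
  have k : ∀ i j k l : Fin 2, kronSq U (finProdFinEquiv (i, j)) (finProdFinEquiv (k, l))
      = U i k * U j l := fun i j k l => by simp [kronSq]
  have k0 : ∀ j, kronSq U 0 j = ![U 0 0 * U 0 0, U 0 0 * U 0 1, U 0 1 * U 0 0, U 0 1 * U 0 1] j := by
    intro j
    fin_cases j
    exacts [k 0 0 0 0, k 0 0 0 1, k 0 0 1 0, k 0 0 1 1]
  have k1 : ∀ j, kronSq U 1 j = ![U 0 0 * U 1 0, U 0 0 * U 1 1, U 0 1 * U 1 0, U 0 1 * U 1 1] j := by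
    intro j
    fin_cases j
    exacts [k 0 1 0 0, k 0 1 0 1, k 0 1 1 0, k 0 1 1 1]
  rw [hE]
  simp only [Matrix.mul_apply, Fin.sum_univ_four, Matrix.transpose_apply, k0, k1]
  ext i j
  fin_cases i <;> fin_cases j <;> simp [W₀]
  · linear_combination (U 0 0 * U 0 0 + U 0 1 * U 0 1 + 1) * h00
  · linear_combination (U 0 0 * U 0 0 + U 0 1 * U 0 1) * h01
  · linear_combination (U 0 0 * U 0 0 + U 0 1 * U 0 1) * h01
  · linear_combination (U 0 0 * U 0 0 + U 0 1 * U 0 1) * h11 + h00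

/-- With `r = √(l₁l₂)` the numerator is `r (l₁ + l₂ - 2r) / 2` and `(l₁ - l₂)² = (l₁ + l₂ - 2r)(l₁ +
l₂ + 2r)`. The common factor causes the `0 / 0`; after cancellation the value `1 / 8` at `l₁ = l₂`
needs no separate treatment. -/
theorem wCoeff_eq {l₁ l₂ : ℝ} (h₁ : 0 < l₁) (h₂ : 0 < l₂) :
    wCoeff l₁ l₂ = √(l₁ * l₂) / (2 * (l₁ + l₂ + 2 * √(l₁ * l₂))) := by
  rw [wCoeff]
  split_ifs with h
  · subst h
    rw [Real.sqrt_mul_self h₁.le]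
    field_simp
    norm_num
  · have hr : √(l₁ * l₂) ^ 2 = l₁ * l₂ := Real.sq_sqrt (by positivity)
    have hp : 0 < √(l₁ * l₂) := Real.sqrt_pos.2 (by positivity)
    have : l₁ - l₂ ≠ 0 := sub_ne_zero.2 h
    generalize √(l₁ * l₂) = r at *
    rw [div_eq_div_iff (by positivity) (by positivity)]
    linear_combination (2 * (l₁ + l₂)) * hr

theorem WV₀_eq {V U : Matrix (Fin 2) (Fin 2) ℝ} {l₁ l₂ : ℝ} (hV : V.PosDef)
    (hU : U ∈ Matrix.orthogonalGroup (Fin 2) ℝ)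
    (hVU : V = U * Matrix.diagonal ![l₁, l₂] * U.transpose) (a ρ : ℝ) :
    WV₀ a ρ U l₁ l₂ =
      ((1 - ‖meanDirSq V‖ ^ 2) / 8) • (G₂ a ρ * (G₂ a ρ).transpose) := by
  have hUt : U.transpose * U = 1 := (Matrix.mem_orthogonalGroup_iff' (Fin 2) ℝ).1 hU
  have htr : l₁ + l₂ = V 0 0 + V 1 1 := by
    rw [← Matrix.trace_fin_two, hVU, Matrix.trace_mul_cycle, hUt, Matrix.one_mul]
    simp
  have hdet : l₁ * l₂ = V.det := by
    have h1 : U.det * U.det = 1 := by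
      have := congrArg Matrix.det hUt
      simpa [Matrix.det_mul, Matrix.det_transpose] using this
    rw [hVU, Matrix.det_mul, Matrix.det_mul, Matrix.det_transpose, Matrix.det_diagonal]
    simp [Fin.prod_univ_two]
    linear_combination (-(l₁ * l₂)) * h1
  have hpos : 0 < l₁ ∧ 0 < l₂ := by
    have h0 := diag_pos_of_posDef hV 0
    have h1 := diag_pos_of_posDef hV 1
    rcases mul_pos_iff.1 (hdet ▸ hV.det_pos) with h | h
    · exact h
    · linarith [h.1, h.2]
  have hw : wCoeff l₁ l₂ = (1 - ‖meanDirSq V‖ ^ 2) / 8 := by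
    rw [wCoeff_eq hpos.1 hpos.2, one_sub_norm_meanDirSq_sq hV, hdet, htr]
    have := trace_add_pos hV
    field_simp
    ring
  have hb := kronSq_conj_W₀_block hU
  rw [WV₀, WS, G_eq, hw]
  rw [Matrix.transpose_mul]
  simp only [Matrix.mul_smul, Matrix.smul_mul]
  congr 1
  calc _ = G₂ a ρ * ((!![1, 0, 0, 0; 0, 1, 0, 0] : Matrix (Fin 2) (Fin 4) ℝ) *
      (kronSq U * W₀ * (kronSq U).transpose) *
      (!![1, 0, 0, 0; 0, 1, 0, 0] : Matrix (Fin 2) (Fin 4) ℝ).transpose) * (G₂ a ρ).transpose := by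
        simp only [Matrix.mul_assoc]
    _ = _ := by rw [hb, Matrix.mul_one]

theorem WV₀_posSemidef {V U : Matrix (Fin 2) (Fin 2) ℝ} {l₁ l₂ : ℝ} (hV : V.PosDef)
    (hU : U ∈ Matrix.orthogonalGroup (Fin 2) ℝ)
    (hVU : V = U * Matrix.diagonal ![l₁, l₂] * U.transpose) (a ρ : ℝ) :
    (WV₀ a ρ U l₁ l₂).PosSemidef := by
  rw [WV₀_eq hV hU hVU]
  have h := Matrix.posSemidef_self_mul_conjTranspose (G₂ a ρ)
  rw [Matrix.conjTranspose_eq_transpose_of_trivial] at h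
  refine h.smul ?_
  have := norm_meanDirSq_lt_one hV
  have := norm_nonneg (meanDirSq V)
  have : ‖meanDirSq V‖ ^ 2 ≤ 1 := by nlinarith
  linarith

end Covariance

/-! ### The shape parameters as a function of the mean doubled-angle direction -/

/-- The parameters `(a, ρ)` of the shape, as a function of the mean doubled-angle direction. -/
def dirSqToParam (q : ℂ) : Vec 2 :=
  !₂[‖1 + q‖ / ‖1 - q‖, 2 * q.im / (‖1 + q‖ * ‖1 - q‖)]

theorem one_add_ne_zero_of_norm_lt_one {q : ℂ} (hq : ‖q‖ < 1) : 1 + q ≠ 0 := by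
  intro h
  have : q = -1 := by linear_combination h
  simp [this] at hq

theorem one_sub_ne_zero_of_norm_lt_one {q : ℂ} (hq : ‖q‖ < 1) : 1 - q ≠ 0 := by
  intro h
  have : q = 1 := by linear_combination -h
  simp [this] at hq

theorem differentiableAt_dirSqToParam {q : ℂ} (hq : ‖q‖ < 1) :
    DifferentiableAt ℝ dirSqToParam q := by
  have h1 := one_add_ne_zero_of_norm_lt_one hq
  have h2 := one_sub_ne_zero_of_norm_lt_one hq
  have d1 : DifferentiableAt ℝ (fun q : ℂ => ‖1 + q‖) q :=
    DifferentiableAt.norm ℝ (by fun_prop) h1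
  have d2 : DifferentiableAt ℝ (fun q : ℂ => ‖1 - q‖) q :=
    DifferentiableAt.norm ℝ (by fun_prop) h2
  have d3 : DifferentiableAt ℝ (fun q : ℂ => q.im) q := Complex.imCLM.differentiableAt
  have n1 := norm_ne_zero_iff.2 h1
  have n2 := norm_ne_zero_iff.2 h2
  rw [differentiableAt_euclidean]
  intro i
  fin_cases i
  · change DifferentiableAt ℝ (fun q : ℂ => ‖1 + q‖ / ‖1 - q‖) q
    fun_prop (disch := assumption)
  · change DifferentiableAt ℝ (fun q : ℂ => 2 * q.im / (‖1 + q‖ * ‖1 - q‖)) q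
    have := mul_ne_zero n1 n2
    fun_prop (disch := assumption)

/-- The mean doubled-angle direction from the elements `(s₁₁, s₁₂)` of the spatial sign covariance
matrix. -/
def sscmToDirSq (s : Fin 2 → ℝ) : ℂ := ⟨2 * s 0 - 1, 2 * s 1⟩

/-- With `M = a² + 2ar + 1` and `r = √(1 - ρ²)` one finds `‖1 + q‖ = 2a/√M`, `‖1 - q‖ = 2/√M` and
`Im q = 2aρ/M`, from which `a` and `ρ` are recovered. -/
theorem dirSqToParam_sscmToDirSq {θ : Fin 2 → ℝ} (ha : 0 < θ 0) (hρ : θ 1 ^ 2 < 1) :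
    dirSqToParam (sscmToDirSq (paramToSSCM θ)) = WithLp.toLp 2 θ := by
  have hr : 0 < √(1 - θ 1 ^ 2) := Real.sqrt_pos.2 (by linarith)
  have hr2 : √(1 - θ 1 ^ 2) ^ 2 = 1 - θ 1 ^ 2 := Real.sq_sqrt (by linarith)
  rw [paramToSSCM_eq ha hρ]
  generalize ha' : θ 0 = a at *
  generalize hρ' : θ 1 = ρ at *
  generalize √(1 - ρ ^ 2) = r at *
  have hN : 0 < a + a⁻¹ + 2 * r := by positivity
  have hM : 0 < a ^ 2 + 2 * a * r + 1 := by positivity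
  have hNM : a + a⁻¹ + 2 * r = (a ^ 2 + 2 * a * r + 1) / a := by field_simp; ring
  set q := sscmToDirSq ![(a + r) / (a + a⁻¹ + 2 * r), ρ / (a + a⁻¹ + 2 * r)] with hq
  have e1 : ‖1 + q‖ = 2 * a / √(a ^ 2 + 2 * a * r + 1) := by
    rw [Complex.norm_def, Real.sqrt_eq_iff_mul_self_eq (Complex.normSq_nonneg _) (by positivity)]
    rw [div_mul_div_comm, Real.mul_self_sqrt hM.le, Complex.normSq_apply]
    simp [hq, sscmToDirSq]
    rw [hNM]
    field_simp
    linear_combination hr2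
  have e2 : ‖1 - q‖ = 2 / √(a ^ 2 + 2 * a * r + 1) := by
    rw [Complex.norm_def, Real.sqrt_eq_iff_mul_self_eq (Complex.normSq_nonneg _) (by positivity)]
    rw [div_mul_div_comm, Real.mul_self_sqrt hM.le, Complex.normSq_apply]
    simp [hq, sscmToDirSq]
    rw [hNM]
    field_simp
    linear_combination (4 * a ^ 2) * hr2
  have e3 : q.im = 2 * ρ * a / (a ^ 2 + 2 * a * r + 1) := by
    simp [hq, sscmToDirSq]
    rw [hNM]
    field_simp
  have hs : √(a ^ 2 + 2 * a * r + 1) * √(a ^ 2 + 2 * a * r + 1) = a ^ 2 + 2 * a * r + 1 :=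
    Real.mul_self_sqrt hM.le
  have hsp : 0 < √(a ^ 2 + 2 * a * r + 1) := Real.sqrt_pos.2 hM
  ext i
  fin_cases i
  · simp [dirSqToParam, e1, e2, ha']
    field_simp
  · simp [dirSqToParam, e1, e2, e3, hρ']
    rw [div_mul_div_comm, hs]
    field_simp

theorem dirSqToParam_meanDirSq {V : Matrix (Fin 2) (Fin 2) ℝ} (hV : V.PosDef) :
    dirSqToParam (meanDirSq V) = !₂[ratio V, corr V] := by
  have h := dirSqToParam_sscmToDirSq (θ := ![ratio V, corr V]) (by simpa using ratio_pos hV)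
    (by simpa using corr_sq_lt_one hV)
  rw [paramToSSCM_ratio_corr hV] at h
  convert h using 2
  apply Complex.ext <;> simp [sscmToDirSq] <;> ring

/-- The derivative of `dirSqToParam` at the mean doubled-angle direction is given by `G`. -/
theorem hasFDerivAt_dirSqToParam {V : Matrix (Fin 2) (Fin 2) ℝ} (hV : V.PosDef) :
    ∃ L : ℂ →L[ℝ] Vec 2, HasFDerivAt dirSqToParam L (meanDirSq V) ∧
      ∀ z : ℂ, L z = WithLp.toLp 2 ((G₂ (ratio V) (corr V)).mulVec ![z.re / 2, z.im / 2]) := by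
  have hL := (differentiableAt_dirSqToParam (norm_meanDirSq_lt_one hV)).hasFDerivAt
  set L := fderiv ℝ dirSqToParam (meanDirSq V)
  refine ⟨L, hL, fun z => ?_⟩
  set a := ratio V with ha
  set ρ := corr V with hρ
  have hGD : G₂ a ρ * jacobian a ρ = 1 := G₂_mul_jacobian (ratio_pos hV) (corr_sq_lt_one hV)
  have hDG : jacobian a ρ * G₂ a ρ = 1 := mul_eq_one_comm.1 hGD
  have hJ : HasFDerivAt paramToSSCM
      (LinearMap.toContinuousLinearMap (Matrix.toLin' (jacobian a ρ))) ![a, ρ] :=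
    hasFDerivAt_paramToSSCM (ratio_pos hV) (corr_sq_lt_one hV)
  let M : (Fin 2 → ℝ) →ₗ[ℝ] ℂ :=
    { toFun := fun s => ⟨2 * s 0, 2 * s 1⟩
      map_add' := fun s t => by apply Complex.ext <;> simp <;> ring
      map_smul' := fun c s => by apply Complex.ext <;> simp <;> ring }
  have hM : HasFDerivAt sscmToDirSq (LinearMap.toContinuousLinearMap M) (paramToSSCM ![a, ρ]) := by
    have : sscmToDirSq = fun s => LinearMap.toContinuousLinearMap M s - 1 := by
      ext s
      apply Complex.ext <;> simp [sscmToDirSq, M]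
    rw [this]
    exact (LinearMap.toContinuousLinearMap M).hasFDerivAt.sub_const 1
  have hq : sscmToDirSq (paramToSSCM ![a, ρ]) = meanDirSq V := by
    rw [paramToSSCM_ratio_corr hV]
    apply Complex.ext <;> simp [sscmToDirSq] <;> ring
  have hcomp := (hq ▸ hL : HasFDerivAt dirSqToParam L (sscmToDirSq (paramToSSCM ![a, ρ]))).comp
    ![a, ρ] (hM.comp ![a, ρ] hJ)
  have hid : HasFDerivAt (fun θ : Fin 2 → ℝ => (WithLp.toLp 2 θ : Vec 2))
      ((EuclideanSpace.equiv (Fin 2) ℝ).symm : (Fin 2 → ℝ) →L[ℝ] Vec 2) ![a, ρ] :=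
    ((EuclideanSpace.equiv (Fin 2) ℝ).symm : (Fin 2 → ℝ) →L[ℝ] Vec 2).hasFDerivAt
  have heq : (dirSqToParam ∘ sscmToDirSq ∘ paramToSSCM) =ᶠ[𝓝 ![a, ρ]]
      fun θ : Fin 2 → ℝ => (WithLp.toLp 2 θ : Vec 2) := by
    have c0 : ∀ᶠ θ : Fin 2 → ℝ in 𝓝 ![a, ρ], 0 < θ 0 :=
      (continuous_apply 0).continuousAt.eventually
        (lt_mem_nhds (by simpa using ratio_pos hV))
    have c1 : ∀ᶠ θ : Fin 2 → ℝ in 𝓝 ![a, ρ], θ 1 ^ 2 < 1 :=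
      ((continuous_apply 1).pow 2).continuousAt.eventually
        (gt_mem_nhds (by simpa using corr_sq_lt_one hV))
    filter_upwards [c0, c1] with θ h0 h1
    exact dirSqToParam_sscmToDirSq h0 h1
  -- The composite is the identity near `(a, ρ)`, so uniqueness of the derivative gives `L ∘ M ∘
  -- jacobian = id`. Evaluating at `G₂ v`, a preimage of `v` under `jacobian`, determines `L`.
  have huniq := (hcomp.congr_of_eventuallyEq heq.symm).unique hid
  have := congrArg (fun T : (Fin 2 → ℝ) →L[ℝ] Vec 2 =>
    T ((G₂ a ρ).mulVec ![z.re / 2, z.im / 2])) huniq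
  simp only [ContinuousLinearMap.comp_apply, LinearMap.coe_toContinuousLinearMap',
    Matrix.toLin'_apply, Matrix.mulVec_mulVec, hDG, Matrix.one_mulVec] at this
  have hz : M ![z.re / 2, z.im / 2] = z := by
    apply Complex.ext <;> simp [M] <;> ring
  rw [hz] at this
  exact this

/-- The estimator in terms of the entries of the sign covariance matrix. -/
theorem diagNormalize_shape_eq {e : ℝ} {q : ℂ} (hq : ‖q‖ < e) {S : Matrix (Fin 2) (Fin 2) ℝ}
    (hS : S = !![(e + q.re) / 2, q.im / 2; q.im / 2, (e - q.re) / 2]) :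
    diagNormalize (S.det⁻¹ • (S * S)) =
      !![dirSqToParam (q / e) 0, dirSqToParam (q / e) 1;
        dirSqToParam (q / e) 1, (dirSqToParam (q / e) 0)⁻¹] := by
  have he : 0 < e := (norm_nonneg q).trans_lt hq
  have hq2 : q.re ^ 2 + q.im ^ 2 < e ^ 2 := by
    have := Complex.normSq_eq_norm_sq q
    rw [Complex.normSq_apply] at this
    nlinarith [norm_nonneg q]
  have hdet : S.det = (e ^ 2 - q.re ^ 2 - q.im ^ 2) / 4 := by
    rw [hS, Matrix.det_fin_two]; simp; ring
  have hdp : 0 < S.det := by rw [hdet]; linarith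
  have hlt : ‖q / e‖ < 1 := by
    rw [norm_div, Complex.norm_real, Real.norm_eq_abs, abs_of_pos he, div_lt_one he]; exact hq
  have p1 : 0 < ‖1 + q / e‖ := norm_pos_iff.2 (one_add_ne_zero_of_norm_lt_one hlt)
  have p2 : 0 < ‖1 - q / e‖ := norm_pos_iff.2 (one_sub_ne_zero_of_norm_lt_one hlt)
  have n1 : ‖1 + q / e‖ ^ 2 = ((e + q.re) ^ 2 + q.im ^ 2) / e ^ 2 := by
    rw [← Complex.normSq_eq_norm_sq, Complex.normSq_apply]
    simp [Complex.div_ofReal_re, Complex.div_ofReal_im]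
    field_simp
  have n2 : ‖1 - q / e‖ ^ 2 = ((e - q.re) ^ 2 + q.im ^ 2) / e ^ 2 := by
    rw [← Complex.normSq_eq_norm_sq, Complex.normSq_apply]
    simp [Complex.div_ofReal_re, Complex.div_ofReal_im]
    field_simp
  set A := ‖1 + q / e‖
  set B := ‖1 - q / e‖
  -- This is the origin of `dirSqToParam`: the diagonal of `S²` is proportional to `‖1 + q/e‖²` and
  -- `‖1 - q/e‖²`, and normalization removes the proportionality factor.
  have hT : S * S = (e ^ 2 / 4) • !![A ^ 2, 2 * (q.im / e); 2 * (q.im / e), B ^ 2] := by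
    rw [n1, n2, hS]
    ext i j
    fin_cases i <;> fin_cases j <;> simp [Matrix.mul_apply, Fin.sum_univ_two] <;> field_simp <;>
      ring
  set c := S.det⁻¹ * (e ^ 2 / 4) with hc
  have hcp : 0 < c := by positivity
  have him : (q / e).im = q.im / e := by simp [Complex.div_ofReal_im]
  rw [hT, smul_smul, ← hc, diagNormalize]
  have hsq : √((c • !![A ^ 2, 2 * (q.im / e); 2 * (q.im / e), B ^ 2] :
        Matrix (Fin 2) (Fin 2) ℝ) 0 0 *
      (c • !![A ^ 2, 2 * (q.im / e); 2 * (q.im / e), B ^ 2] : Matrix (Fin 2) (Fin 2) ℝ) 1 1)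
      = c * A * B := by
    rw [Real.sqrt_eq_iff_mul_self_eq]
    · simp; ring
    · simp; positivity
    · positivity
  have d0 : dirSqToParam (q / e) 0 = A / B := rfl
  have d1 : dirSqToParam (q / e) 1 = 2 * (q.im / e) / (A * B) := by rw [← him]; rfl
  rw [hsq, d0, d1]
  ext i j
  fin_cases i <;> fin_cases j <;> simp <;> field_simp

/-! ### Doubled-angle directions -/

/-- The square `w² / ‖w‖²` of the direction of `w`, and `0` for `w = 0`. -/
def dirSq (w : ℂ) : ℂ := w / conj w

theorem norm_dirSq {w : ℂ} (hw : w ≠ 0) : ‖dirSq w‖ = 1 := by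
  rw [dirSq, norm_div, Complex.norm_conj, div_self (norm_ne_zero_iff.2 hw)]

theorem norm_dirSq_le (w : ℂ) : ‖dirSq w‖ ≤ 1 := by
  by_cases hw : w = 0
  · simp [hw, dirSq]
  · exact (norm_dirSq hw).le

theorem measurable_dirSq : Measurable dirSq := by
  unfold dirSq
  exact measurable_id.div (Complex.continuous_conj.measurable)

/-- First order expansion of `dirSq`. -/
theorem norm_dirSq_sub_sub_le {y : ℂ} (hy : y ≠ 0) (t : ℂ) :
    ‖dirSq (y - t) - dirSq y + (t * (conj y)⁻¹ - conj t * (y / conj y ^ 2))‖ ≤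
      10 * (‖t‖ ^ (3 / 2 : ℝ) * ‖y‖ ^ (-(3 / 2) : ℝ)) := by
  have hcy : conj y ≠ 0 := by simpa using hy
  -- The error depends only on `τ`, up to the unimodular factor `dirSq y`. It is `O(‖τ‖²)` for small
  -- and `O(‖τ‖)` for large `τ`; the intermediate power `3/2` serves both regimes, and `‖y‖^(-3/2)`
  -- is locally integrable in the plane, whereas `‖y‖^(-2)` is not.
  set τ := t / y with hτ
  have ht : t = τ * y := by rw [hτ]; field_simp
  obtain ⟨s, hs⟩ : ∃ s, s = √‖τ‖ := ⟨_, rfl⟩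
  have hs0 : 0 ≤ s := hs ▸ Real.sqrt_nonneg _
  have hs2 : ‖τ‖ = s ^ 2 := by rw [hs, Real.sq_sqrt (norm_nonneg _)]
  have hs3 : ‖t‖ ^ (3 / 2 : ℝ) * ‖y‖ ^ (-(3 / 2) : ℝ) = s ^ 3 := by
    rw [Real.rpow_neg (norm_nonneg _), ← div_eq_mul_inv,
      ← Real.div_rpow (norm_nonneg _) (norm_nonneg _), ← norm_div, ← hτ, hs2, ← Real.rpow_natCast,
      ← Real.rpow_natCast, ← Real.rpow_mul hs0]
    norm_num
  rw [hs3]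
  have hq := norm_dirSq hy
  have hlin : t * (conj y)⁻¹ - conj t * (y / conj y ^ 2) = dirSq y * (τ - conj τ) := by
    rw [ht, dirSq, map_mul]
    field_simp
  rw [hlin]
  have hlin' : ‖dirSq y * (τ - conj τ)‖ ≤ 2 * s ^ 2 := by
    rw [norm_mul, hq, one_mul]
    refine (norm_sub_le _ _).trans ?_
    rw [Complex.norm_conj, hs2]; linarith
  rcases le_or_gt ‖τ‖ (1 / 2) with h | h
  · have h1 : (1 : ℝ) / 2 ≤ ‖1 - conj τ‖ := by
      have := norm_sub_norm_le (1 : ℂ) (conj τ)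
      rw [norm_one, Complex.norm_conj] at this
      linarith
    have hne : 1 - conj τ ≠ 0 := by
      intro h0
      rw [h0, norm_zero] at h1
      norm_num at h1
    have hne' : conj (y - t) ≠ 0 := by
      have : conj (y - t) = conj y * (1 - conj τ) := by
        rw [ht]; simp; ring
      rw [this]
      exact mul_ne_zero hcy hne
    have key : dirSq (y - t) - dirSq y + dirSq y * (τ - conj τ)
        = dirSq y * ((conj τ ^ 2 - τ * conj τ) / (1 - conj τ)) := by
      have e1 : dirSq (y - t) = dirSq y * ((1 - τ) / (1 - conj τ)) := by
        have : conj (y - t) = conj y * (1 - conj τ) := by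
          rw [ht]; simp; ring
        rw [dirSq, this, dirSq, ht]
        field_simp
      rw [e1]
      field_simp
      ring
    rw [key, norm_mul, hq, one_mul, norm_div, div_le_iff₀ (by linarith)]
    have h2 : ‖conj τ ^ 2 - τ * conj τ‖ ≤ 2 * (s ^ 2) ^ 2 := by
      refine (norm_sub_le _ _).trans ?_
      rw [norm_pow, norm_mul, Complex.norm_conj, hs2]
      linarith
    have hs1 : s ≤ 1 := by nlinarith
    calc _ ≤ 2 * (s ^ 2) ^ 2 := h2
      _ ≤ 10 * s ^ 3 * (1 / 2) := by
        have : s ^ 3 * s ≤ s ^ 3 * 1 := mul_le_mul_of_nonneg_left hs1 (by positivity)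
        nlinarith [pow_nonneg hs0 3]
      _ ≤ _ := by gcongr
  -- `7/10` is a rational lower bound for `√(1/2)`; it absorbs the crude bound `2 + 2s²` into `10
  -- s³`.
  · have hs1 : 7 / 10 ≤ s := by
      by_contra hcon
      push Not at hcon
      nlinarith
    have h1 : ‖dirSq (y - t) - dirSq y‖ ≤ 2 := by
      refine (norm_sub_le _ _).trans ?_
      linarith [norm_dirSq_le (y - t)]
    refine (norm_add_le _ _).trans ?_
    have : s ^ 2 * (7 / 10) ≤ s ^ 2 * s := mul_le_mul_of_nonneg_left hs1 (by positivity)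
    nlinarith

/-- The left side is zero unless `y = t`, and then both sides equal one. It measures the trace lost
when an observation coincides with the centre. -/
theorem one_sub_norm_dirSq_sub_le {y : ℂ} (hy : y ≠ 0) (t : ℂ) :
    1 - ‖dirSq (y - t)‖ ≤ ‖t‖ ^ (3 / 2 : ℝ) * ‖y‖ ^ (-(3 / 2) : ℝ) := by
  by_cases h : y - t = 0
  · rw [sub_eq_zero] at h
    subst h
    rw [← Real.rpow_add (norm_pos_iff.2 hy)]
    simp [dirSq]
  · rw [norm_dirSq h, sub_self]
    positivity

/-! ### Deterministic bounds for samples -/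

/-- The average of `f` over `y 0, …, y (n - 1)`. -/
def avg {α E : Type*} [AddCommGroup E] [Module ℝ E] (n : ℕ) (y : ℕ → α) (f : α → E) : E :=
  (n : ℝ)⁻¹ • ∑ i ∈ Finset.range n, f (y i)

/-- The direction `w / ‖w‖`. -/
def dir (w : ℂ) : ℂ := w / ‖w‖

/-- The weight in the quadratic lower bound for the distance function. -/
def distWeight (w : ℂ) : ℝ := (4 * (1 + ‖w‖))⁻¹

theorem norm_dir_le (w : ℂ) : ‖dir w‖ ≤ 1 := by
  rw [dir, norm_div, Complex.norm_real, norm_norm]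
  exact div_self_le_one _

theorem measurable_dir : Measurable dir := by
  unfold dir
  fun_prop

theorem distWeight_pos (w : ℂ) : 0 < distWeight w := by
  unfold distWeight
  positivity

theorem distWeight_le (w : ℂ) : distWeight w ≤ 1 := by
  unfold distWeight
  refine inv_le_one_of_one_le₀ ?_
  linarith [norm_nonneg w]

theorem measurable_distWeight : Measurable distWeight := by
  unfold distWeight
  fun_prop

/-- Quadratic lower bound for the distance function near the origin. -/
theorem distWeight_mul_le_norm_sub {y t : ℂ} (hy : y ≠ 0) (ht : ‖t‖ ≤ 1) :
    -(t * conj (dir y)).re + distWeight y * (‖t‖ ^ 2 - (t ^ 2 * conj (dirSq y)).re) ≤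
      ‖y - t‖ - ‖y‖ := by
  have hny : 0 < ‖y‖ := norm_pos_iff.2 hy
  have hns : ‖dir y‖ = 1 := by
    rw [dir, norm_div, Complex.norm_real, norm_norm, div_self hny.ne']
  have hcs : ‖y‖ * dir y = y := by
    rw [dir, mul_div_cancel₀]
    exact_mod_cast hny.ne'
  have hq : dirSq y = dir y ^ 2 := by
    have h2 : y * conj y = (‖y‖ : ℂ) ^ 2 := Complex.mul_conj' y
    have hcy : conj y ≠ 0 := by simpa using hy
    have : (‖y‖ : ℂ) ≠ 0 := by exact_mod_cast hny.ne'
    rw [dirSq, dir, div_pow, ← h2]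
    field_simp
  set s := dir y with hs
  set z := t * conj s with hz
  have hzn : ‖z‖ = ‖t‖ := by rw [hz, norm_mul, Complex.norm_conj, hns, mul_one]
  have hz2 : t ^ 2 * conj (dirSq y) = z ^ 2 := by
    rw [hq, hz, map_pow]; ring
  have hzsq : ‖t‖ ^ 2 = z.re ^ 2 + z.im ^ 2 := by
    rw [← hzn, ← Complex.normSq_eq_norm_sq, Complex.normSq_apply]; ring
  have hre : (z ^ 2).re = z.re ^ 2 - z.im ^ 2 := by rw [sq, Complex.mul_re]; ring
  -- Rotating by `conj s` moves `y` to the positive real axis and `t` to `z`.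
  have hdist : ‖y - t‖ ^ 2 = (‖y‖ - z.re) ^ 2 + z.im ^ 2 := by
    have e : ‖y - t‖ = ‖(‖y‖ : ℂ) - z‖ := by
      have hss : s * conj s = 1 := by
        rw [Complex.mul_conj', hns]; simp
      have : (y - t) * conj s = ‖y‖ - z := by
        rw [hz, sub_mul]
        conv_lhs => rw [← hcs]
        rw [mul_assoc, hss, mul_one]
      rw [← this, norm_mul, Complex.norm_conj, hns, mul_one]
    rw [e, ← Complex.normSq_eq_norm_sq, Complex.normSq_apply]
    simp
    ring
  rw [hz2, hre, hzsq, distWeight]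
  have hA : ‖y - t‖ ≤ ‖y‖ + 1 := (norm_sub_le _ _).trans (by linarith)
  have hzre : |z.re| ≤ 1 := (Complex.abs_re_le_norm z).trans (hzn ▸ ht)
  have hb := abs_le.1 hzre
  have hAb : ‖y‖ - z.re ≤ ‖y - t‖ := by
    refine le_trans (le_abs_self _) (abs_le_of_sq_le_sq ?_ (norm_nonneg _))
    rw [hdist]
    linarith [sq_nonneg z.im]
  have hI : (‖y - t‖ - (‖y‖ - z.re)) * (‖y - t‖ + (‖y‖ - z.re)) = z.im ^ 2 := by
    linear_combination hdist
  -- The second factor of the difference of squares is at most `2 (1 + ‖y‖)`. As `‖t‖² - Re z² = 2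
  -- (Im z)²`, this yields the weight `1 / (4 (1 + ‖y‖))`.
  have h3 : z.im ^ 2 ≤ (‖y - t‖ - (‖y‖ - z.re)) * (2 * (1 + ‖y‖)) := by
    rw [← hI]
    refine mul_le_mul_of_nonneg_left ?_ (by linarith)
    linarith [hb.1]
  have h4 : (4 * (1 + ‖y‖))⁻¹ * (z.re ^ 2 + z.im ^ 2 - (z.re ^ 2 - z.im ^ 2))
      = z.im ^ 2 / (2 * (1 + ‖y‖)) := by
    field_simp
    ring
  rw [h4]
  have := (div_le_iff₀ (by positivity)).2 h3
  linarith

/-- A spatial median is controlled by the average of the directions. -/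
theorem norm_spatialMedian_le {n : ℕ} {y : ℕ → ℂ} (hy : ∀ i, y i ≠ 0) {t : ℂ}
    (ht : ∀ u : ℂ, ∑ i ∈ Finset.range n, ‖y i - t‖ ≤ ∑ i ∈ Finset.range n, ‖y i - u‖)
    {c : ℝ} (hc : c ≤ avg n y distWeight - ‖avg n y fun w => (distWeight w : ℂ) * dirSq w‖)
    (hs : ‖avg n y dir‖ < c) :
    c * ‖t‖ ≤ ‖avg n y dir‖ := by
  have hn0 : 0 ≤ (n : ℝ)⁻¹ := by positivity
  -- Averaging the pointwise lower bound gives a quadratic minorant of the objective on the unit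
  -- disc, with curvature at least `c`.
  have key : ∀ u : ℂ, ‖u‖ ≤ 1 → c * ‖u‖ ^ 2 - ‖u‖ * ‖avg n y dir‖ ≤
      (n : ℝ)⁻¹ * ∑ i ∈ Finset.range n, (‖y i - u‖ - ‖y i‖) := by
    intro u hu
    have h1 : (n : ℝ)⁻¹ * ∑ i ∈ Finset.range n, (-(u * conj (dir (y i))).re +
        distWeight (y i) * (‖u‖ ^ 2 - (u ^ 2 * conj (dirSq (y i))).re)) ≤
        (n : ℝ)⁻¹ * ∑ i ∈ Finset.range n, (‖y i - u‖ - ‖y i‖) :=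
      mul_le_mul_of_nonneg_left
        (Finset.sum_le_sum fun i _ => distWeight_mul_le_norm_sub (hy i) hu) hn0
    refine le_trans ?_ h1
    have h2 : (n : ℝ)⁻¹ * ∑ i ∈ Finset.range n, (-(u * conj (dir (y i))).re +
        distWeight (y i) * (‖u‖ ^ 2 - (u ^ 2 * conj (dirSq (y i))).re)) =
        -(u * conj (avg n y dir)).re + ‖u‖ ^ 2 * avg n y distWeight -
          (u ^ 2 * conj (avg n y fun w => (distWeight w : ℂ) * dirSq w)).re := by
      have a1 : (u * conj (avg n y dir)).re =
          (n : ℝ)⁻¹ * ∑ i ∈ Finset.range n, (u * conj (dir (y i))).re := by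
        rw [avg, Complex.real_smul, map_mul, Complex.conj_ofReal, map_sum, ← Complex.re_sum,
          ← Finset.mul_sum, ← Complex.re_ofReal_mul]
        congr 1; ring
      have a2 : (u ^ 2 * conj (avg n y fun w => (distWeight w : ℂ) * dirSq w)).re =
          (n : ℝ)⁻¹ * ∑ i ∈ Finset.range n, distWeight (y i) * (u ^ 2 * conj (dirSq (y i))).re := by
        simp_rw [← Complex.re_ofReal_mul]
        rw [avg, Complex.real_smul, map_mul, Complex.conj_ofReal, map_sum, ← Complex.re_sum,
          ← Complex.re_ofReal_mul, mul_left_comm, Finset.mul_sum]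
        congr 3
        ext i
        rw [map_mul, Complex.conj_ofReal]; ring
      rw [a1, a2, avg, smul_eq_mul]
      simp only [mul_sub, Finset.sum_add_distrib, Finset.sum_sub_distrib, Finset.sum_neg_distrib,
        ← Finset.sum_mul]
      ring
    rw [h2]
    have b1 : (u * conj (avg n y dir)).re ≤ ‖u‖ * ‖avg n y dir‖ := by
      refine (Complex.re_le_norm _).trans ?_
      rw [norm_mul, Complex.norm_conj]
    have b2 : (u ^ 2 * conj (avg n y fun w => (distWeight w : ℂ) * dirSq w)).re ≤
        ‖u‖ ^ 2 * ‖avg n y fun w => (distWeight w : ℂ) * dirSq w‖ := by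
      refine (Complex.re_le_norm _).trans ?_
      rw [norm_mul, Complex.norm_conj, norm_pow]
    nlinarith [sq_nonneg ‖u‖]
  have hM : (n : ℝ)⁻¹ * ∑ i ∈ Finset.range n, (‖y i - t‖ - ‖y i‖) ≤ 0 := by
    refine mul_nonpos_of_nonneg_of_nonpos hn0 ?_
    have := ht 0
    simp only [sub_zero] at this
    rw [Finset.sum_sub_distrib]
    linarith
  by_cases ht1 : ‖t‖ ≤ 1
  · have := (key t ht1).trans hM
    by_cases h0 : ‖t‖ = 0
    · rw [h0, mul_zero]; exact norm_nonneg _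
    · have hp : 0 < ‖t‖ := lt_of_le_of_ne (norm_nonneg _) (Ne.symm h0)
      refine le_of_mul_le_mul_left ?_ hp
      nlinarith
  -- A minimizer outside the unit disc is excluded by convexity: at `t / ‖t‖` the objective would
  -- not exceed its value at zero, while `key` gives an excess of at least `c - ‖avg n y dir‖ > 0`.
  · exfalso
    push Not at ht1
    have hp : 0 < ‖t‖ := by linarith
    set r : ℝ := ‖t‖⁻¹ with hr
    have hr0 : 0 < r := inv_pos.2 hp
    have hr1 : r ≤ 1 := inv_le_one_of_one_le₀ ht1.le
    have hu : ‖(r : ℂ) * t‖ = 1 := by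
      rw [norm_mul, Complex.norm_real, Real.norm_eq_abs, abs_of_pos hr0, hr, inv_mul_cancel₀ hp.ne']
    have h1 := key (r * t) hu.le
    rw [hu] at h1
    have h2 : (n : ℝ)⁻¹ * ∑ i ∈ Finset.range n, (‖y i - r * t‖ - ‖y i‖) ≤
        r * ((n : ℝ)⁻¹ * ∑ i ∈ Finset.range n, (‖y i - t‖ - ‖y i‖)) := by
      rw [mul_left_comm r, Finset.mul_sum (f := fun i => ‖y i - t‖ - ‖y i‖)]
      refine mul_le_mul_of_nonneg_left (Finset.sum_le_sum fun i _ => ?_) hn0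
      have : y i - r * t = r * (y i - t) + ((1 - r : ℝ) : ℂ) * y i := by push_cast; ring
      have h3 : ‖y i - r * t‖ ≤ r * ‖y i - t‖ + (1 - r) * ‖y i‖ := by
        rw [this]
        refine (norm_add_le _ _).trans ?_
        rw [norm_mul, norm_mul, Complex.norm_real, Complex.norm_real, Real.norm_eq_abs,
          Real.norm_eq_abs, abs_of_pos hr0, abs_of_nonneg (by linarith)]
      nlinarith
    have h3 := mul_nonpos_of_nonneg_of_nonpos hr0.le hM
    linarith

theorem norm_avg_le {α E : Type*} [NormedAddCommGroup E] [NormedSpace ℝ E] (n : ℕ) (y : ℕ → α)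
    {f : α → E} {g : α → ℝ} (h : ∀ i, ‖f (y i)‖ ≤ g (y i)) : ‖avg n y f‖ ≤ avg n y g := by
  rw [avg, avg, norm_smul, Real.norm_eq_abs, abs_of_nonneg (by positivity), smul_eq_mul]
  exact mul_le_mul_of_nonneg_left (norm_sum_le_of_le _ fun i _ => h i) (by positivity)

/-- The normalized average doubled-angle direction around `t`. -/
def dirSqEst (n : ℕ) (y : ℕ → ℂ) (t : ℂ) : ℂ :=
  (avg n y fun w => dirSq (w - t)) / (avg n y fun w => ‖dirSq (w - t)‖ : ℝ)

theorem norm_avg_dirSq_sub_sub_le {n : ℕ} {y : ℕ → ℂ} (hy : ∀ i, y i ≠ 0) (t : ℂ) :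
    ‖(avg n y fun w => dirSq (w - t)) - avg n y dirSq‖ ≤
      ‖t‖ * (‖avg n y fun w => (conj w)⁻¹‖ + ‖avg n y fun w => w / conj w ^ 2‖) +
        10 * ‖t‖ ^ (3 / 2 : ℝ) * avg n y fun w => ‖w‖ ^ (-(3 / 2) : ℝ) := by
  have h1 : ‖avg n y fun w => dirSq (w - t) - dirSq w +
      (t * (conj w)⁻¹ - conj t * (w / conj w ^ 2))‖ ≤
      avg n y fun w => 10 * (‖t‖ ^ (3 / 2 : ℝ) * ‖w‖ ^ (-(3 / 2) : ℝ)) :=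
    norm_avg_le n y fun i => norm_dirSq_sub_sub_le (hy i) t
  have h2 : (avg n y fun w => dirSq (w - t) - dirSq w +
      (t * (conj w)⁻¹ - conj t * (w / conj w ^ 2))) =
      ((avg n y fun w => dirSq (w - t)) - avg n y dirSq) +
        (t * (avg n y fun w => (conj w)⁻¹) - conj t * avg n y fun w => w / conj w ^ 2) := by
    simp only [avg, Finset.sum_add_distrib, Finset.sum_sub_distrib, ← Finset.mul_sum, smul_add,
      smul_sub, mul_smul_comm]
  have h3 : (avg n y fun w => 10 * (‖t‖ ^ (3 / 2 : ℝ) * ‖w‖ ^ (-(3 / 2) : ℝ))) =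
      10 * ‖t‖ ^ (3 / 2 : ℝ) * avg n y fun w => ‖w‖ ^ (-(3 / 2) : ℝ) := by
    simp only [avg, ← Finset.mul_sum, smul_eq_mul]; ring
  rw [h2, h3] at h1
  set A := (avg n y fun w => dirSq (w - t)) - avg n y dirSq
  set B := t * (avg n y fun w => (conj w)⁻¹) - conj t * avg n y fun w => w / conj w ^ 2
  have h4 : ‖A‖ ≤ ‖A + B‖ + ‖B‖ := by
    have := norm_sub_le (A + B) B
    simpa using this
  have h5 : ‖B‖ ≤ ‖t‖ * (‖avg n y fun w => (conj w)⁻¹‖ + ‖avg n y fun w => w / conj w ^ 2‖) := by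
    refine (norm_sub_le _ _).trans ?_
    rw [norm_mul, norm_mul, Complex.norm_conj]
    linarith
  linarith

theorem one_sub_avg_norm_dirSq_le {n : ℕ} (hn : n ≠ 0) {y : ℕ → ℂ} (hy : ∀ i, y i ≠ 0) (t : ℂ) :
    1 - (avg n y fun w => ‖dirSq (w - t)‖) ≤
      ‖t‖ ^ (3 / 2 : ℝ) * avg n y fun w => ‖w‖ ^ (-(3 / 2) : ℝ) := by
  have hn' : (n : ℝ) ≠ 0 := by exact_mod_cast hn
  have h1 : 1 - (avg n y fun w => ‖dirSq (w - t)‖) =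
      (n : ℝ)⁻¹ * ∑ i ∈ Finset.range n, (1 - ‖dirSq (y i - t)‖) := by
    rw [Finset.sum_sub_distrib, avg]
    simp [mul_sub, hn']
  rw [h1, avg, smul_eq_mul, mul_left_comm (‖t‖ ^ _),
    Finset.mul_sum (f := fun i => ‖y i‖ ^ (-(3 / 2) : ℝ))]
  exact mul_le_mul_of_nonneg_left
    (Finset.sum_le_sum fun i _ => one_sub_norm_dirSq_sub_le (hy i) t) (inv_nonneg.2 (Nat.cast_nonneg n))

/-- Dividing the mean by the trace `e` costs at most `1 - e`, which is of the order of the expansion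
error; this turns the constant `10` into `11`. -/
theorem norm_dirSqEst_sub_avg_le {n : ℕ} (hn : n ≠ 0) {y : ℕ → ℂ} (hy : ∀ i, y i ≠ 0) (t : ℂ) :
    ‖dirSqEst n y t - avg n y dirSq‖ ≤
      ‖t‖ * (‖avg n y fun w => (conj w)⁻¹‖ + ‖avg n y fun w => w / conj w ^ 2‖ +
        11 * ‖t‖ ^ (1 / 2 : ℝ) * avg n y fun w => ‖w‖ ^ (-(3 / 2) : ℝ)) := by
  have h1 := norm_avg_dirSq_sub_sub_le (n := n) hy t
  have h2 := one_sub_avg_norm_dirSq_le hn hy t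
  have h3 : ‖dirSqEst n y t - avg n y fun w => dirSq (w - t)‖ ≤
      1 - avg n y fun w => ‖dirSq (w - t)‖ := by
    have hle : ‖avg n y fun w => dirSq (w - t)‖ ≤ avg n y fun w => ‖dirSq (w - t)‖ :=
      norm_avg_le n y fun i => le_rfl
    have hE1 : (avg n y fun w => ‖dirSq (w - t)‖) ≤ 1 := by
      rw [avg, smul_eq_mul, inv_mul_le_iff₀ (by exact_mod_cast Nat.pos_of_ne_zero hn)]
      refine (Finset.sum_le_sum fun i _ => norm_dirSq_le _).trans ?_
      simp
    rw [dirSqEst]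
    set Q := avg n y fun w => dirSq (w - t)
    set e := avg n y fun w => ‖dirSq (w - t)‖
    rcases eq_or_lt_of_le ((norm_nonneg Q).trans hle) with h0 | h0
    · have : Q = 0 := norm_le_zero_iff.1 (h0 ▸ hle)
      simp [this, hE1]
    · have : Q / (e : ℂ) - Q = Q / e * ((1 - e : ℝ) : ℂ) := by
        have : (e : ℂ) ≠ 0 := by exact_mod_cast h0.ne'
        push_cast
        field_simp
      rw [this, norm_mul, norm_div, Complex.norm_real, Complex.norm_real, Real.norm_eq_abs,
        Real.norm_eq_abs, abs_of_pos h0, abs_of_nonneg (by linarith)]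
      exact mul_le_of_le_one_left (by linarith) ((div_le_one h0).2 hle)
  have h4 : ‖t‖ ^ (3 / 2 : ℝ) = ‖t‖ * ‖t‖ ^ (1 / 2 : ℝ) := by
    rw [show (3 / 2 : ℝ) = 1 + 1 / 2 by norm_num, Real.rpow_add' (norm_nonneg _) (by norm_num),
      Real.rpow_one]
  rw [h4] at h1 h2
  have h5 := norm_add_le (dirSqEst n y t - avg n y fun w => dirSq (w - t))
    ((avg n y fun w => dirSq (w - t)) - avg n y dirSq)
  rw [sub_add_sub_cancel] at h5
  linarith

/-! ### Limit theorems -/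

section Limit

variable {Ω : Type*} [MeasurableSpace Ω] {P : Measure Ω}

/-- The Cramér–Wold device in terms of characteristic functions: it reduces the multivariate limit
theorem to the real one. -/
theorem charFun_map_eq_charFun_map_inner {p : ℕ} {Z : Ω → Vec p} (hZ : AEMeasurable Z P)
    (t : Vec p) : charFun (P.map Z) t = charFun (P.map fun ω => inner ℝ (Z ω) t) 1 := by
  have hin : AEMeasurable (fun ω => inner ℝ (Z ω) t) P := hZ.inner_const
  rw [charFun_apply, charFun_apply, integral_map hZ, integral_map hin]
  · simp
  · exact (by fun_prop : Continuous _).aestronglyMeasurable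
  · exact (by fun_prop : Continuous _).aestronglyMeasurable

/-- The **multivariate central limit theorem** for centred random vectors. -/
theorem tendstoInDistribution_multivariateGaussian [IsProbabilityMeasure P] {p : ℕ}
    {S : Matrix (Fin p) (Fin p) ℝ} (hS : S.PosSemidef) {X : ℕ → Ω → Vec p}
    (hindep : iIndepFun X P) (hident : ∀ i, IdentDistrib (X i) (X 0) P P)
    (hmem : MemLp (X 0) 2 P) (hmean : ∫ ω, X 0 ω ∂P = 0)
    (hcov : ∀ t : Vec p, ∫ ω, (inner ℝ (X 0 ω) t) ^ 2 ∂P = t.ofLp ⬝ᵥ S.mulVec t.ofLp) :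
    TendstoInDistribution (fun (n : ℕ) ω => (√n)⁻¹ • ∑ k ∈ Finset.range n, X k ω) atTop id
      (fun _ => P) (multivariateGaussian 0 S) where
  forall_aemeasurable n :=
    (Finset.aemeasurable_fun_sum _ fun i _ => (hident i).aemeasurable_fst).fun_const_smul _
  tendsto := by
    have hmeas : ∀ n : ℕ, AEMeasurable (fun ω => (√n)⁻¹ • ∑ k ∈ Finset.range n, X k ω) P := fun n =>
      (Finset.aemeasurable_fun_sum _ fun i _ => (hident i).aemeasurable_fst).fun_const_smul _
    refine ProbabilityMeasure.tendsto_iff_tendsto_charFun.2 fun t => ?_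
    simp only [ProbabilityMeasure.coe_mk, Measure.map_id]
    have hm0 : ∫ ω, inner ℝ (X 0 ω) t ∂P = 0 := by
      have := integral_inner (𝕜 := ℝ) (hmem.integrable (by norm_num)) t
      rw [hmean, inner_zero_right] at this
      simpa only [real_inner_comm] using this
    have hmeas0 : AEMeasurable (fun ω => inner ℝ (X 0 ω) t) P :=
      (hident 0).aemeasurable_fst.inner_const
    have hvar : Var[fun ω => inner ℝ (X 0 ω) t; P] = t.ofLp ⬝ᵥ S.mulVec t.ofLp := by
      rw [variance_of_integral_eq_zero hmeas0 hm0, hcov]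
    have hclt := tendstoInDistribution_inv_sqrt_mul_sum_sub (P := P)
      (X := fun k ω => inner ℝ (X k ω) t) (Y := id)
      (P' := gaussianReal 0 Var[fun ω => inner ℝ (X 0 ω) t; P].toNNReal) HasLaw.id
      (hmem.inner_const t)
      (hindep.comp (fun _ x => inner ℝ x t) fun _ => by fun_prop)
      (fun i => (hident i).comp (u := fun x => inner ℝ x t) (by fun_prop))
    have h1 := ProbabilityMeasure.tendsto_iff_tendsto_charFun.1 hclt.tendsto 1
    simp only [ProbabilityMeasure.coe_mk, Measure.map_id, charFun_gaussianReal, hm0, mul_zero,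
      sub_zero] at h1
    rw [charFun_multivariateGaussian hS]
    refine (h1.congr fun n => ?_).trans_eq ?_
    · rw [charFun_map_eq_charFun_map_inner (hmeas n)]
      congr 2
      ext ω
      simp [inner_smul_left, sum_inner]
    · rw [hvar, Real.coe_toNNReal _ (by
        simpa using hS.dotProduct_mulVec_nonneg t.ofLp)]
      simp

/-- The strong law of large numbers for averages of a function of i.i.d. variables. -/
theorem tendsto_avg_ae {α E : Type*} [MeasurableSpace α] [NormedAddCommGroup E] [NormedSpace ℝ E]
    [CompleteSpace E] [MeasurableSpace E] [BorelSpace E] {ν : Measure α} {Y : ℕ → Ω → α}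
    (hlaw : ∀ i, HasLaw (Y i) ν P) (hindep : iIndepFun Y P) {f : α → E} (hf : Measurable f)
    (hint : Integrable f ν) :
    ∀ᵐ ω ∂P, Tendsto (fun n => avg n (fun i => Y i ω) f) atTop (𝓝 (∫ x, f x ∂ν)) := by
  have h0 : ∫ ω, f (Y 0 ω) ∂P = ∫ x, f x ∂ν := (hlaw 0).integral_comp hint.1
  rw [← h0]
  refine strong_law_ae (fun i ω => f (Y i ω)) ?_ ?_ ?_
  · have := hint
    rw [← (hlaw 0).map_eq] at this
    exact this.comp_aemeasurable (hlaw 0).aemeasurable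
  · intro i j hij
    exact (hindep.indepFun hij).comp hf hf
  · intro i
    exact ((hlaw i).identDistrib (hlaw 0)).comp hf

/-- A sequence of random variables is bounded (from above) in probability. -/
def BoundedInProb (P : Measure Ω) (B : ℕ → Ω → ℝ) : Prop :=
  ∀ ε : ENNReal, 0 < ε → ∃ M : ℝ, ∀ n, P {ω | M ≤ B n ω} ≤ ε

theorem BoundedInProb.add {B C : ℕ → Ω → ℝ} (hB : BoundedInProb P B) (hC : BoundedInProb P C) :
    BoundedInProb P fun n ω => B n ω + C n ω := by
  intro ε hε
  obtain ⟨M, hM⟩ := hB (ε / 2) (ENNReal.half_pos hε.ne')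
  obtain ⟨N, hN⟩ := hC (ε / 2) (ENNReal.half_pos hε.ne')
  refine ⟨M + N, fun n => ?_⟩
  have hsub : {ω | M + N ≤ B n ω + C n ω} ⊆ {ω | M ≤ B n ω} ∪ {ω | N ≤ C n ω} := by
    intro ω hω
    by_contra h
    simp only [Set.mem_union, Set.mem_ofPred_eq, not_or, not_le] at h hω
    linarith [h.1, h.2]
  calc _ ≤ _ := measure_mono hsub
    _ ≤ _ := measure_union_le _ _
    _ ≤ ε / 2 + ε / 2 := add_le_add (hM n) (hN n)
    _ = ε := ENNReal.add_halves ε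

theorem BoundedInProb.mono {B C : ℕ → Ω → ℝ} (hB : BoundedInProb P B)
    (h : ∀ n ω, C n ω ≤ B n ω) : BoundedInProb P C := by
  intro ε hε
  obtain ⟨M, hM⟩ := hB ε hε
  exact ⟨M, fun n => (measure_mono fun ω hω => le_trans hω (h n ω)).trans (hM n)⟩

theorem boundedInProb_const (c : ℝ) : BoundedInProb P fun _ _ => c := by
  intro ε hε
  refine ⟨c + 1, fun n => ?_⟩
  have : {ω : Ω | c + 1 ≤ c} = ∅ := by
    ext ω
    simp
  rw [this]
  simp

/-- The ratio `‖R‖ / B` tends to zero almost surely, hence in probability, and `B` is bounded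
outside an event of small probability. This turns almost sure `o(‖avg dir‖)` estimates into `o_P(1)`
after scaling by `√n`. -/
theorem tendstoInMeasure_zero_of_isLittleO [IsProbabilityMeasure P] {E : Type*}
    [NormedAddCommGroup E] {R : ℕ → Ω → E} {B : ℕ → Ω → ℝ}
    (hR : ∀ n, AEStronglyMeasurable (R n) P) (hBm : ∀ n, AEStronglyMeasurable (B n) P)
    (hB : BoundedInProb P B) (hpos : ∀ n ω, 0 < B n ω)
    (hRB : ∀ᵐ ω ∂P, (fun n => R n ω) =o[atTop] fun n => B n ω) :
    TendstoInMeasure P R atTop 0 := by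
  have hratio : TendstoInMeasure P (fun n ω => ‖R n ω‖ / B n ω) atTop 0 := by
    refine tendstoInMeasure_of_tendsto_ae (fun n => ?_) ?_
    · exact ((hR n).norm.aemeasurable.div (hBm n).aemeasurable).aestronglyMeasurable
    · filter_upwards [hRB] with ω hω
      exact hω.norm_left.tendsto_div_nhds_zero
  rw [tendstoInMeasure_iff_norm] at hratio ⊢
  intro δ hδ
  rw [ENNReal.tendsto_nhds_zero]
  intro ε hε
  obtain ⟨M, hM⟩ := hB (ε / 2) (ENNReal.half_pos hε.ne')
  set M' := max M 1
  have hM'pos : 0 < M' := lt_of_lt_of_le one_pos (le_max_right _ _)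
  filter_upwards [(ENNReal.tendsto_nhds_zero.1 (hratio (δ / M') (by positivity))) (ε / 2)
    (ENNReal.half_pos hε.ne')] with n hn
  have hsub : {ω | δ ≤ ‖R n ω - (0 : Ω → E) ω‖} ⊆
      {ω | δ / M' ≤ ‖‖R n ω‖ / B n ω - (0 : Ω → ℝ) ω‖} ∪ {ω | M ≤ B n ω} := by
    intro ω hω
    by_contra h
    simp only [Set.mem_union, Set.mem_ofPred_eq, not_or, not_le, Pi.zero_apply, sub_zero] at h hω
    obtain ⟨h1, h2⟩ := h
    have hb := hpos n ω
    rw [Real.norm_eq_abs, abs_of_nonneg (by positivity), div_lt_iff₀ hb] at h1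
    have h3 : B n ω ≤ M' := h2.le.trans (le_max_left _ _)
    have : δ / M' * B n ω ≤ δ / M' * M' := mul_le_mul_of_nonneg_left h3 (by positivity)
    rw [div_mul_cancel₀ _ hM'pos.ne'] at this
    linarith
  calc _ ≤ _ := measure_mono hsub
    _ ≤ _ := measure_union_le _ _
    _ ≤ ε / 2 + ε / 2 := add_le_add hn (hM n)
    _ = ε := ENNReal.add_halves ε

/-- Chebyshev's inequality: the sum of `n` independent centred terms bounded by `K` has variance at
most `n K²`, so the bound `K² / M²` is uniform in `n`. -/
theorem boundedInProb_sqrt_mul_avg_real [IsProbabilityMeasure P] {α : Type*} [MeasurableSpace α]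
    {ν : Measure α} {Y : ℕ → Ω → α} (hlaw : ∀ i, HasLaw (Y i) ν P) (hindep : iIndepFun Y P)
    {f : α → ℝ} (hf : Measurable f) {K : ℝ} (hK : ∀ x, ‖f x‖ ≤ K) (hmean : ∫ x, f x ∂ν = 0) :
    BoundedInProb P fun n ω => √n * |avg n (fun i => Y i ω) f| := by
  have hmem : ∀ i, MemLp (fun ω => f (Y i ω)) 2 P := fun i =>
    MemLp.of_bound (hf.comp_aemeasurable (hlaw i).aemeasurable).aestronglyMeasurable K
      (ae_of_all _ fun ω => hK _)
  have hzero : ∀ i, ∫ ω, f (Y i ω) ∂P = 0 := fun i => by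
    rw [← hmean]; exact (hlaw i).integral_comp hf.aestronglyMeasurable
  have hv : ∀ i, Var[fun ω => f (Y i ω); P] ≤ K ^ 2 := by
    intro i
    rw [variance_of_integral_eq_zero (hmem i).1.aemeasurable (hzero i)]
    have : ∫ ω, f (Y i ω) ^ 2 ∂P ≤ ∫ _, K ^ 2 ∂P := by
      refine integral_mono (hmem i).integrable_sq (integrable_const _) fun ω => ?_
      have := hK (Y i ω)
      rw [Real.norm_eq_abs] at this
      exact sq_le_sq' (neg_le_of_abs_le this) (le_of_abs_le this)
    simpa using this
  intro ε hε
  obtain ⟨M, hMpos, hM⟩ : ∃ M : ℝ, 0 < M ∧ ENNReal.ofReal (K ^ 2 / M ^ 2) ≤ ε := by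
    have : Tendsto (fun M : ℝ => ENNReal.ofReal (K ^ 2 / M ^ 2)) atTop (𝓝 0) := by
      rw [← ENNReal.ofReal_zero]
      refine ENNReal.tendsto_ofReal ?_
      exact tendsto_const_nhds.div_atTop (tendsto_pow_atTop two_ne_zero)
    obtain ⟨M, h1, h2⟩ := ((eventually_gt_atTop (0 : ℝ)).and
      (ENNReal.tendsto_nhds_zero.1 this ε hε)).exists
    exact ⟨M, h1, h2⟩
  refine ⟨M, fun n => ?_⟩
  rcases Nat.eq_zero_or_pos n with rfl | hn
  · have : {ω | M ≤ √(0 : ℕ) * |avg 0 (fun i => Y i ω) f|} = ∅ := by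
      ext ω; simp [hMpos]
    rw [this]; simp
  have hn' : (0 : ℝ) < n := by exact_mod_cast hn
  set Z : Ω → ℝ := ∑ i ∈ Finset.range n, fun ω => f (Y i ω) with hZ
  have hZmem : MemLp Z 2 P := memLp_finsetSum' _ fun i _ => hmem i
  have hZvar : Var[Z; P] ≤ n * K ^ 2 := by
    rw [hZ, IndepFun.variance_sum (fun i _ => hmem i)
      (fun i _ j _ hij => (hindep.indepFun hij).comp hf hf)]
    refine (Finset.sum_le_sum fun i _ => hv i).trans ?_
    simp
  have hZmean : ∫ ω, Z ω ∂P = 0 := by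
    simp only [hZ, Finset.sum_apply]
    rw [integral_finsetSum _ fun i _ => (hmem i).integrable (by norm_num)]
    simp [hzero]
  have hcheb := meas_ge_le_variance_div_sq hZmem (c := √n * M) (by positivity)
  rw [hZmean] at hcheb
  have hset : {ω | M ≤ √n * |avg n (fun i => Y i ω) f|} = {ω | √n * M ≤ |Z ω - 0|} := by
    ext ω
    have hZω : avg n (fun i => Y i ω) f = (n : ℝ)⁻¹ * Z ω := by
      simp [avg, hZ]
    simp only [Set.mem_ofPred_eq, hZω, sub_zero, abs_mul, abs_inv, Nat.abs_cast]
    have hs : 0 < √(n : ℝ) := Real.sqrt_pos.2 hn'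
    have hss : √(n : ℝ) * √(n : ℝ) = n := Real.mul_self_sqrt hn'.le
    have : √(n : ℝ) * ((n : ℝ)⁻¹ * |Z ω|) = |Z ω| / √(n : ℝ) := by
      rw [eq_div_iff hs.ne']
      calc √(n : ℝ) * ((n : ℝ)⁻¹ * |Z ω|) * √(n : ℝ)
          = (√(n : ℝ) * √(n : ℝ)) * (n : ℝ)⁻¹ * |Z ω| := by ring
        _ = |Z ω| := by rw [hss, mul_inv_cancel₀ hn'.ne', one_mul]
    rw [this, le_div_iff₀ hs, mul_comm]
  rw [hset]
  refine hcheb.trans (le_trans (ENNReal.ofReal_le_ofReal ?_) hM)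
  rw [mul_pow, Real.sq_sqrt hn'.le, div_le_div_iff₀ (by positivity) (by positivity)]
  calc Var[Z; P] * M ^ 2 ≤ (n * K ^ 2) * M ^ 2 := by gcongr
    _ = K ^ 2 * (n * M ^ 2) := by ring

theorem boundedInProb_sqrt_mul_avg [IsProbabilityMeasure P] {α : Type*} [MeasurableSpace α]
    {ν : Measure α} [IsProbabilityMeasure ν] {Y : ℕ → Ω → α} (hlaw : ∀ i, HasLaw (Y i) ν P)
    (hindep : iIndepFun Y P)
    {f : α → ℂ} (hf : Measurable f) {K : ℝ} (hK : ∀ x, ‖f x‖ ≤ K) (hmean : ∫ x, f x ∂ν = 0) :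
    BoundedInProb P fun n ω => √n * ‖avg n (fun i => Y i ω) f‖ := by
  have hint : Integrable f ν := Integrable.of_bound hf.aestronglyMeasurable K (ae_of_all _ hK)
  have h1 := boundedInProb_sqrt_mul_avg_real hlaw hindep (f := fun x => (f x).re) (by fun_prop)
    (fun x => (Complex.abs_re_le_norm _).trans (hK x)) (by
      have := integral_re hint
      rw [hmean] at this
      simpa using this)
  have h2 := boundedInProb_sqrt_mul_avg_real hlaw hindep (f := fun x => (f x).im) (by fun_prop)
    (fun x => (Complex.abs_im_le_norm _).trans (hK x)) (by
      have := integral_im hint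
      rw [hmean] at this
      simpa using this)
  refine (h1.add h2).mono fun n ω => ?_
  have hre : (avg n (fun i => Y i ω) f).re = avg n (fun i => Y i ω) fun x => (f x).re := by
    simp [avg]
  have him : (avg n (fun i => Y i ω) f).im = avg n (fun i => Y i ω) fun x => (f x).im := by
    simp [avg]
  rw [← mul_add, ← hre, ← him]
  exact mul_le_mul_of_nonneg_left (Complex.norm_le_abs_re_add_abs_im _) (Real.sqrt_nonneg _)

end Limit

/-! ### Asymptotics of the mean doubled-angle direction around the spatial median -/

/-- The properties of the law of a centred elliptical vector that determine the asymptotics of its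
spatial sign covariance matrix. -/
structure IsDirLaw (ν : Measure ℂ) (q₀ : ℂ) : Prop where
  isProbabilityMeasure : IsProbabilityMeasure ν
  ae_ne_zero : ∀ᵐ z ∂ν, z ≠ 0
  integrable_rpow : Integrable (fun z : ℂ => ‖z‖ ^ (-(3 / 2) : ℝ)) ν
  integral_odd : ∀ f : ℂ → ℂ, (∀ z, f (-z) = -f z) → ∫ z, f z ∂ν = 0
  integral_dirSq : ∫ z, dirSq z ∂ν = q₀
  integral_dirSq_sq : ∫ z, dirSq z ^ 2 ∂ν = q₀ ^ 2
  norm_lt_one : ‖q₀‖ < 1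

namespace IsDirLaw

variable {ν : Measure ℂ} {q₀ : ℂ}

theorem integrable_of_bound [IsProbabilityMeasure ν] {E : Type*} [NormedAddCommGroup E]
    [MeasurableSpace E] [BorelSpace E] [SecondCountableTopology E] {f : ℂ → E} (hf : Measurable f)
    {K : ℝ} (hK : ∀ z, ‖f z‖ ≤ K) : Integrable f ν :=
  Integrable.of_bound hf.aestronglyMeasurable K (ae_of_all _ hK)

/-- `‖z‖⁻¹ ≤ 1 + ‖z‖^(-3/2)`. It applies to the linear coefficients in the expansion of `dirSq`. -/
theorem integrable_of_norm_le_inv (h : IsDirLaw ν q₀) {f : ℂ → ℂ} (hf : Measurable f)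
    (hK : ∀ z, ‖f z‖ ≤ ‖z‖⁻¹) : Integrable f ν := by
  have := h.isProbabilityMeasure
  refine ((integrable_const (1 : ℝ)).add h.integrable_rpow).mono' hf.aestronglyMeasurable
    (ae_of_all _ fun z => (hK z).trans ?_)
  simp only [Pi.add_apply]
  rcases le_or_gt 1 ‖z‖ with h1 | h1
  · have : ‖z‖⁻¹ ≤ 1 := inv_le_one_of_one_le₀ h1
    have : 0 ≤ ‖z‖ ^ (-(3 / 2) : ℝ) := by positivity
    linarith
  · rcases eq_or_lt_of_le (norm_nonneg z) with h0 | h0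
    · rw [← h0, inv_zero]
      positivity
    · have : ‖z‖ ^ (-1 : ℝ) ≤ ‖z‖ ^ (-(3 / 2) : ℝ) :=
        Real.rpow_le_rpow_of_exponent_ge h0 h1.le (by norm_num)
      rw [Real.rpow_neg_one] at this
      linarith

/-- Equality would force `dirSq` to be almost surely constant in one real direction, and then `‖q₀‖
= 1`. The strict gap is the curvature of the median's objective function at the centre. -/
theorem norm_integral_lt (h : IsDirLaw ν q₀) :
    ‖∫ z, (distWeight z : ℂ) * dirSq z ∂ν‖ < ∫ z, distWeight z ∂ν := by
  have := h.isProbabilityMeasure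
  have hmwq : Measurable fun z => (distWeight z : ℂ) * dirSq z :=
    (Complex.measurable_ofReal.comp measurable_distWeight).mul measurable_dirSq
  have hwq : Integrable (fun z => (distWeight z : ℂ) * dirSq z) ν := by
    refine integrable_of_bound hmwq (K := 1) fun z => ?_
    rw [norm_mul, Complex.norm_real, Real.norm_eq_abs, abs_of_pos (distWeight_pos z)]
    exact mul_le_one₀ (distWeight_le z) (norm_nonneg _) (norm_dirSq_le z)
  have hw : Integrable distWeight ν := by
    refine integrable_of_bound measurable_distWeight (K := 1) fun z => ?_
    rw [Real.norm_eq_abs, abs_of_pos (distWeight_pos z)]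
    exact distWeight_le z
  have hq : Integrable dirSq ν := integrable_of_bound measurable_dirSq norm_dirSq_le
  set c := ∫ z, (distWeight z : ℂ) * dirSq z ∂ν with hc
  obtain ⟨u, hu, huc⟩ : ∃ u : ℂ, ‖u‖ ≤ 1 ∧ u * c = ‖c‖ := by
    by_cases h0 : c = 0
    · exact ⟨0, by simp, by simp [h0]⟩
    · have hn : (‖c‖ : ℂ) ≠ 0 := by exact_mod_cast norm_ne_zero_iff.2 h0
      refine ⟨conj c / ‖c‖, ?_, ?_⟩
      · rw [norm_div, Complex.norm_conj, Complex.norm_real, norm_norm]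
        exact div_self_le_one _
      · rw [div_mul_eq_mul_div, mul_comm, Complex.mul_conj', sq, mul_div_assoc, div_self hn, mul_one]
  have hint1 : Integrable (fun z => (u * ((distWeight z : ℂ) * dirSq z)).re) ν :=
    (hwq.const_mul u).re
  have heq : (∫ z, distWeight z ∂ν) - ‖c‖ = ∫ z, distWeight z * (1 - (u * dirSq z).re) ∂ν := by
    have h1 : ‖c‖ = ∫ z, (u * ((distWeight z : ℂ) * dirSq z)).re ∂ν := by
      have h2 : ∫ z, (u * ((distWeight z : ℂ) * dirSq z)).re ∂ν
          = (∫ z, u * ((distWeight z : ℂ) * dirSq z) ∂ν).re := integral_re (hwq.const_mul u)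
      rw [h2, integral_const_mul, ← hc, huc, Complex.ofReal_re]
    rw [h1, ← integral_sub hw hint1]
    congr 1
    ext z
    rw [mul_left_comm, Complex.re_ofReal_mul]
    ring
  have hnn : ∀ z, 0 ≤ 1 - (u * dirSq z).re := by
    intro z
    have h1 := Complex.re_le_norm (u * dirSq z)
    rw [norm_mul] at h1
    have h2 := mul_le_one₀ hu (norm_nonneg _) (norm_dirSq_le z)
    linarith
  have hint2 : Integrable (fun z => distWeight z * (1 - (u * dirSq z).re)) ν := by
    refine (hw.sub hint1).congr (ae_of_all _ fun z => ?_)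
    simp only [Pi.sub_apply]
    rw [mul_left_comm, Complex.re_ofReal_mul]
    ring
  have hge : 0 ≤ ∫ z, distWeight z * (1 - (u * dirSq z).re) ∂ν :=
    integral_nonneg fun z => mul_nonneg (distWeight_pos z).le (hnn z)
  refine lt_of_le_of_ne (by linarith) fun hcon => ?_
  have hz : ∫ z, distWeight z * (1 - (u * dirSq z).re) ∂ν = 0 := by linarith
  rw [integral_eq_zero_iff_of_nonneg (fun z => mul_nonneg (distWeight_pos z).le (hnn z)) hint2] at hz
  have h1 : ∀ᵐ z ∂ν, (u * dirSq z).re = 1 := by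
    filter_upwards [hz] with z hz
    rcases mul_eq_zero.1 hz with h | h
    · exact absurd h (distWeight_pos z).ne'
    · linarith
  have h2 : (u * q₀).re = 1 := by
    have h3 : ∫ z, (u * dirSq z).re ∂ν = (∫ z, u * dirSq z ∂ν).re := integral_re (hq.const_mul u)
    rw [integral_const_mul, h.integral_dirSq] at h3
    rw [← h3, integral_congr_ae h1]
    simp
  have h3 := Complex.re_le_norm (u * q₀)
  rw [norm_mul, h2] at h3
  have h4 := h.norm_lt_one
  nlinarith [norm_nonneg q₀, norm_nonneg u]

/-- The integrand is the square of `Re ((a - ib)(d - q₀))`, which is half of `(a² + b²) ‖d - q₀‖² +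
Re ((a - ib)² (d - q₀)²)`. The second term has mean zero because `E d² = q₀²`; the first has `E ‖d -
q₀‖² = 1 - ‖q₀‖²`. -/
theorem integral_linear_sq (h : IsDirLaw ν q₀) (a b : ℝ) :
    ∫ z, (a * (dirSq z - q₀).re + b * (dirSq z - q₀).im) ^ 2 ∂ν =
      (a ^ 2 + b ^ 2) * ((1 - ‖q₀‖ ^ 2) / 2) := by
  have := h.isProbabilityMeasure
  have hq : Integrable dirSq ν := integrable_of_bound measurable_dirSq norm_dirSq_le
  have hq2 : Integrable (fun z => dirSq z ^ 2) ν :=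
    integrable_of_bound (K := 1) (measurable_dirSq.pow_const 2) fun z => by
      rw [norm_pow]; exact pow_le_one₀ (norm_nonneg _) (norm_dirSq_le z)
  have hf : ∀ᵐ z ∂ν, (a * (dirSq z - q₀).re + b * (dirSq z - q₀).im) ^ 2 =
      (((a ^ 2 + b ^ 2) / 2 * (1 + ‖q₀‖ ^ 2) : ℝ) -
        ((a ^ 2 + b ^ 2 : ℝ) : ℂ) * (conj q₀ * dirSq z) +
        (((a ^ 2 - b ^ 2) / 2 : ℝ) - (a * b : ℝ) * Complex.I) *
          (dirSq z ^ 2 - 2 * q₀ * dirSq z + q₀ ^ 2)).re := by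
    filter_upwards [h.ae_ne_zero] with z hz
    have h1 : (dirSq z).re ^ 2 + (dirSq z).im ^ 2 = 1 := by
      have h2 := Complex.normSq_eq_norm_sq (dirSq z)
      rw [norm_dirSq hz, Complex.normSq_apply] at h2
      linarith
    have h2 : ‖q₀‖ ^ 2 = q₀.re ^ 2 + q₀.im ^ 2 := by
      rw [← Complex.normSq_eq_norm_sq, Complex.normSq_apply]; ring
    rw [h2]
    simp [sq]
    linear_combination ((a ^ 2 + b ^ 2) / 2) * h1
  rw [integral_congr_ae hf]
  have hi1 : Integrable (fun z => (((a ^ 2 + b ^ 2) / 2 * (1 + ‖q₀‖ ^ 2) : ℝ) : ℂ) -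
        ((a ^ 2 + b ^ 2 : ℝ) : ℂ) * (conj q₀ * dirSq z)) ν :=
    (integrable_const _).sub ((hq.const_mul _).const_mul _)
  have hi2a : Integrable (fun z => dirSq z ^ 2 - 2 * q₀ * dirSq z) ν := hq2.sub (hq.const_mul _)
  have hi2 : Integrable (fun z => dirSq z ^ 2 - 2 * q₀ * dirSq z + q₀ ^ 2) ν :=
    hi2a.add (integrable_const _)
  have hre := integral_re (hi1.add (hi2.const_mul
    ((((a ^ 2 - b ^ 2) / 2 : ℝ) : ℂ) - (a * b : ℝ) * Complex.I)))
  refine (Eq.trans ?_ hre).trans ?_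
  · rfl
  · simp only [Pi.add_apply]
    rw [integral_add hi1 (hi2.const_mul _), integral_const_mul, integral_add hi2a (integrable_const _),
      integral_sub hq2 (hq.const_mul _), integral_sub (integrable_const _)
      ((hq.const_mul _).const_mul _), integral_const_mul, integral_const_mul, integral_const_mul,
      h.integral_dirSq, h.integral_dirSq_sq]
    have h2 : ‖q₀‖ ^ 2 = q₀.re ^ 2 + q₀.im ^ 2 := by
      rw [← Complex.normSq_eq_norm_sq, Complex.normSq_apply]; ring
    rw [h2]
    simp [sq]
    ring

variable {Ω : Type*} [MeasurableSpace Ω] {P : Measure Ω}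

/-- Almost surely, replacing the centre by the spatial median changes the mean doubled-angle
direction by a term that is negligible compared with the mean direction. -/
theorem ae_dirSqEst (h : IsDirLaw ν q₀) {Y : ℕ → Ω → ℂ} (hlaw : ∀ i, HasLaw (Y i) ν P)
    (hindep : iIndepFun Y P) {t : ℕ → Ω → ℂ}
    (ht : ∀ n, ∀ᵐ ω ∂P, ∀ u : ℂ, ∑ i ∈ Finset.range n, ‖Y i ω - t n ω‖ ≤
      ∑ i ∈ Finset.range n, ‖Y i ω - u‖) :
    ∀ᵐ ω ∂P,
      ((fun n => dirSqEst n (fun i => Y i ω) (t n ω) - avg n (fun i => Y i ω) dirSq) =o[atTop]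
        fun n => avg n (fun i => Y i ω) dir) ∧
      Tendsto (fun n => avg n (fun i => Y i ω) dir) atTop (𝓝 0) ∧
      Tendsto (fun n => avg n (fun i => Y i ω) dirSq) atTop (𝓝 q₀) ∧
      Tendsto (fun n => avg n (fun i => Y i ω) fun w => ‖dirSq (w - t n ω)‖) atTop (𝓝 1) := by
  have := h.isProbabilityMeasure
  have hmwq : Measurable fun z => (distWeight z : ℂ) * dirSq z :=
    (Complex.measurable_ofReal.comp measurable_distWeight).mul measurable_dirSq
  have hwq : Integrable (fun z => (distWeight z : ℂ) * dirSq z) ν := by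
    refine integrable_of_bound hmwq (K := 1) fun z => ?_
    rw [norm_mul, Complex.norm_real, Real.norm_eq_abs, abs_of_pos (distWeight_pos z)]
    exact mul_le_one₀ (distWeight_le z) (norm_nonneg _) (norm_dirSq_le z)
  have hw : Integrable distWeight ν := by
    refine integrable_of_bound measurable_distWeight (K := 1) fun z => ?_
    rw [Real.norm_eq_abs, abs_of_pos (distWeight_pos z)]
    exact distWeight_le z
  have hconj : Measurable fun w : ℂ => conj w := Complex.continuous_conj.measurable
  have hm1 : Measurable fun w : ℂ => (conj w)⁻¹ := hconj.inv
  have hm2 : Measurable fun w : ℂ => w / conj w ^ 2 := measurable_id.div (hconj.pow_const 2)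
  have hi1 := h.integrable_of_norm_le_inv hm1 fun z => by
    rw [norm_inv, Complex.norm_conj]
  have hi2 := h.integrable_of_norm_le_inv hm2 fun z => by
    rw [norm_div, norm_pow, Complex.norm_conj]
    by_cases hz : ‖z‖ = 0
    · simp [hz]
    · apply le_of_eq
      field_simp
  have ho1 : ∫ w, (conj w)⁻¹ ∂ν = 0 := h.integral_odd _ fun z => by rw [map_neg, inv_neg]
  have ho2 : ∫ w, w / conj w ^ 2 ∂ν = 0 := h.integral_odd _ fun z => by
    rw [map_neg, neg_sq, neg_div]
  have ho3 : ∫ w, dir w ∂ν = 0 := h.integral_odd _ fun z => by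
    rw [dir, dir, norm_neg, neg_div]
  have hne : ∀ᵐ ω ∂P, ∀ i, Y i ω ≠ 0 := by
    rw [ae_all_iff]
    intro i
    exact ((hlaw i).ae_iff (p := fun z => z ≠ 0) (by fun_prop)).2 h.ae_ne_zero
  -- Half of the limiting curvature gap, so that the empirical gap eventually exceeds it.
  set c₀ := ((∫ z, distWeight z ∂ν) - ‖∫ z, (distWeight z : ℂ) * dirSq z ∂ν‖) / 2 with hc₀
  have hc₀pos : 0 < c₀ := by
    have := h.norm_integral_lt
    rw [hc₀]; linarith
  filter_upwards [hne, ae_all_iff.2 ht, tendsto_avg_ae hlaw hindep measurable_distWeight hw,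
    tendsto_avg_ae hlaw hindep hmwq hwq, tendsto_avg_ae hlaw hindep hm1 hi1,
    tendsto_avg_ae hlaw hindep hm2 hi2,
    tendsto_avg_ae hlaw hindep measurable_dir (integrable_of_bound measurable_dir norm_dir_le),
    tendsto_avg_ae hlaw hindep measurable_dirSq (integrable_of_bound measurable_dirSq norm_dirSq_le),
    tendsto_avg_ae hlaw hindep (by fun_prop) h.integrable_rpow]
    with ω hne ht T1 T2 T3 T4 T5 T6 T7
  rw [ho1] at T3
  rw [ho2] at T4
  rw [ho3] at T5
  rw [h.integral_dirSq] at T6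
  have hev1 : ∀ᶠ n in atTop, c₀ ≤ avg n (fun i => Y i ω) distWeight -
      ‖avg n (fun i => Y i ω) fun w => (distWeight w : ℂ) * dirSq w‖ := by
    refine (T1.sub T2.norm).eventually_const_le ?_
    linarith
  have hev2 : ∀ᶠ n in atTop, ‖avg n (fun i => Y i ω) dir‖ < c₀ := by
    have := T5.norm
    rw [norm_zero] at this
    exact this.eventually_lt_const hc₀pos
  have hbound : ∀ᶠ n in atTop, ‖t n ω‖ ≤ c₀⁻¹ * ‖avg n (fun i => Y i ω) dir‖ := by
    filter_upwards [hev1, hev2] with n h1 h2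
    rw [le_inv_mul_iff₀ hc₀pos]
    exact norm_spatialMedian_le hne (ht n) h1 h2
  have hO : (fun n => t n ω) =O[atTop] fun n => avg n (fun i => Y i ω) dir :=
    Asymptotics.IsBigO.of_bound _ hbound
  have ht0 : Tendsto (fun n => t n ω) atTop (𝓝 0) := hO.trans_tendsto T5
  have hpow : ∀ r : ℝ, 0 < r → Tendsto (fun n => ‖t n ω‖ ^ r) atTop (𝓝 0) := by
    intro r hr
    have h1 := ht0.norm.rpow_const (p := r) (Or.inr hr.le)
    rwa [norm_zero, Real.zero_rpow hr.ne'] at h1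
  refine ⟨?_, T5, T6, ?_⟩
  · set η : ℕ → ℝ := fun n => ‖avg n (fun i => Y i ω) fun w => (conj w)⁻¹‖ +
      ‖avg n (fun i => Y i ω) fun w => w / conj w ^ 2‖ + 11 * ‖t n ω‖ ^ (1 / 2 : ℝ) *
        avg n (fun i => Y i ω) fun w => ‖w‖ ^ (-(3 / 2) : ℝ)
    have hη : Tendsto η atTop (𝓝 0) := by
      have := (T3.norm.add T4.norm).add (((hpow (1 / 2) (by norm_num)).const_mul 11).mul T7)
      rwa [norm_zero, mul_zero, zero_mul, add_zero, add_zero] at this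
    have h1 : (fun n => dirSqEst n (fun i => Y i ω) (t n ω) - avg n (fun i => Y i ω) dirSq)
        =O[atTop] fun n => ‖t n ω‖ * η n := by
      refine Asymptotics.IsBigO.of_bound 1 ?_
      filter_upwards [eventually_ne_atTop 0] with n hn
      rw [one_mul]
      exact (norm_dirSqEst_sub_avg_le hn hne (t n ω)).trans (Real.le_norm_self _)
    have h2 : (fun n => ‖t n ω‖ * η n) =o[atTop] fun n => ‖t n ω‖ * (1 : ℝ) :=
      (Asymptotics.isBigO_refl _ _).mul_isLittleO ((Asymptotics.isLittleO_one_iff ℝ).2 hη)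
    simp only [mul_one] at h2
    exact (h1.trans_isLittleO h2).trans_isBigO hO.norm_left
  · have h1 : Tendsto (fun n => 1 - ‖t n ω‖ ^ (3 / 2 : ℝ) *
        avg n (fun i => Y i ω) fun w => ‖w‖ ^ (-(3 / 2) : ℝ)) atTop (𝓝 1) := by
      simpa using ((hpow (3 / 2) (by norm_num)).mul T7).const_sub 1
    refine tendsto_of_tendsto_of_tendsto_of_le_of_le' h1 tendsto_const_nhds ?_ ?_
    · filter_upwards [eventually_ne_atTop 0] with n hn
      have := one_sub_avg_norm_dirSq_le hn hne (t n ω)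
      linarith
    · filter_upwards [eventually_gt_atTop 0] with n hn
      rw [avg, smul_eq_mul, inv_mul_le_iff₀ (by exact_mod_cast hn)]
      refine (Finset.sum_le_sum fun i _ => norm_dirSq_le _).trans ?_
      simp

variable [IsProbabilityMeasure P]

/-- The central limit theorem for a linear image of the mean doubled-angle direction. -/
theorem tendstoInDistribution_avg_dirSq (h : IsDirLaw ν q₀) {Y : ℕ → Ω → ℂ}
    (hlaw : ∀ i, HasLaw (Y i) ν P) (hindep : iIndepFun Y P) (A : Matrix (Fin 2) (Fin 2) ℝ)
    {L : ℂ →L[ℝ] Vec 2} (hL : ∀ z : ℂ, L z = WithLp.toLp 2 (A.mulVec ![z.re / 2, z.im / 2]))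
    (hS : (((1 - ‖q₀‖ ^ 2) / 8) • (A * A.transpose)).PosSemidef) :
    TendstoInDistribution
      (fun (n : ℕ) ω => √n • L (avg n (fun i => Y i ω) fun w => dirSq w - q₀)) atTop id
      (fun _ => P) (multivariateGaussian 0 (((1 - ‖q₀‖ ^ 2) / 8) • (A * A.transpose))) := by
  have := h.isProbabilityMeasure
  have hm : Measurable fun w => L (dirSq w - q₀) :=
    L.continuous.measurable.comp (measurable_dirSq.sub_const _)
  have hq : Integrable dirSq ν := integrable_of_bound measurable_dirSq norm_dirSq_le
  have hb : ∀ w, ‖L (dirSq w - q₀)‖ ≤ ‖L‖ * 2 := by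
    intro w
    refine (L.le_opNorm _).trans (mul_le_mul_of_nonneg_left ?_ (norm_nonneg _))
    refine (norm_sub_le _ _).trans ?_
    linarith [norm_dirSq_le w, h.norm_lt_one]
  have hclt := tendstoInDistribution_multivariateGaussian (P := P) hS
    (X := fun i ω => L (dirSq (Y i ω) - q₀)) (hindep.comp (fun _ w => L (dirSq w - q₀)) fun _ => hm)
    (fun i => ((hlaw i).identDistrib (hlaw 0)).comp hm)
    (MemLp.of_bound (hm.comp_aemeasurable (hlaw 0).aemeasurable).aestronglyMeasurable (‖L‖ * 2)
      (ae_of_all _ fun ω => hb _))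
    (by
      have h1 : ∫ ω, L (dirSq (Y 0 ω) - q₀) ∂P = ∫ w, L (dirSq w - q₀) ∂ν :=
        (hlaw 0).integral_comp hm.aestronglyMeasurable
      have hq0 : Integrable (fun w => dirSq w - q₀) ν := hq.sub (integrable_const _)
      rw [h1, L.integral_comp_comm hq0, integral_sub hq (integrable_const _), h.integral_dirSq]
      simp)
    (by
      intro t
      have h1 : ∫ ω, (inner ℝ (L (dirSq (Y 0 ω) - q₀)) t) ^ 2 ∂P =
          ∫ w, (inner ℝ (L (dirSq w - q₀)) t) ^ 2 ∂ν :=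
        (hlaw 0).integral_comp (f := fun w => (inner ℝ (L (dirSq w - q₀)) t) ^ 2)
          ((hm.inner_const).pow_const 2).aestronglyMeasurable
      -- The factors `1/2` here, once squared, combine with the variance `(1 - ‖q₀‖²) / 2` to `(1 -
      -- ‖q₀‖²) / 8`.
      have h2 : ∀ w, inner ℝ (L (dirSq w - q₀)) t =
          ((A 0 0 * t 0 + A 1 0 * t 1) / 2) * (dirSq w - q₀).re +
            ((A 0 1 * t 0 + A 1 1 * t 1) / 2) * (dirSq w - q₀).im := by
        intro w
        rw [hL]
        simp [PiLp.inner_apply, Fin.sum_univ_two]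
        ring
      rw [h1]
      simp_rw [h2]
      rw [h.integral_linear_sq]
      simp [Matrix.mulVec, dotProduct, Fin.sum_univ_two, Matrix.mul_apply]
      ring)
  convert hclt using 3 with n ω
  rw [avg, map_smul, map_sum, smul_smul]
  congr 1
  rcases Nat.eq_zero_or_pos n with rfl | hn
  · simp
  · have hn' : (0 : ℝ) < n := by exact_mod_cast hn
    have hs : 0 < √(n : ℝ) := Real.sqrt_pos.2 hn'
    have hss : √(n : ℝ) * √(n : ℝ) = n := Real.mul_self_sqrt hn'.le
    rw [← mul_eq_one_iff_eq_inv₀ hs.ne', mul_right_comm, hss, mul_inv_cancel₀ hn'.ne']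

/-- Asymptotic normality of an estimator that is eventually a differentiable function of the mean
doubled-angle direction around the spatial median. -/
theorem tendstoInDistribution_of_eventually_eq (h : IsDirLaw ν q₀) {Y : ℕ → Ω → ℂ}
    (hlaw : ∀ i, HasLaw (Y i) ν P) (hindep : iIndepFun Y P) {t : ℕ → Ω → ℂ}
    (ht : ∀ n, ∀ᵐ ω ∂P, ∀ u : ℂ, ∑ i ∈ Finset.range n, ‖Y i ω - t n ω‖ ≤
      ∑ i ∈ Finset.range n, ‖Y i ω - u‖) {K : ℂ → Vec 2} (A : Matrix (Fin 2) (Fin 2) ℝ)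
    {L : ℂ →L[ℝ] Vec 2} (hK : HasFDerivAt K L q₀)
    (hL : ∀ z : ℂ, L z = WithLp.toLp 2 (A.mulVec ![z.re / 2, z.im / 2]))
    (hS : (((1 - ‖q₀‖ ^ 2) / 8) • (A * A.transpose)).PosSemidef)
    {θhat : ℕ → Ω → Vec 2} (hmeas : ∀ n, AEMeasurable (θhat n) P)
    (heq : ∀ᵐ ω ∂P, ∀ᶠ n in atTop, θhat n ω = K (dirSqEst n (fun i => Y i ω) (t n ω))) :
    TendstoInDistribution (fun (n : ℕ) ω => √n • (θhat n ω - K q₀)) atTop id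
      (fun _ => P) (multivariateGaussian 0 (((1 - ‖q₀‖ ^ 2) / 8) • (A * A.transpose))) := by
  have := h.isProbabilityMeasure
  have hclt := h.tendstoInDistribution_avg_dirSq hlaw hindep A hL hS
  have hmdir : ∀ n, AEMeasurable (fun ω => avg n (fun i => Y i ω) dir) P := fun n =>
    (Finset.aemeasurable_fun_sum _ fun i _ =>
      measurable_dir.comp_aemeasurable (hlaw i).aemeasurable).fun_const_smul _
  have hmdsq : Measurable fun w => dirSq w - q₀ := measurable_dirSq.sub_const _
  have hmsq : ∀ n, AEMeasurable (fun ω => avg n (fun i => Y i ω) fun w => dirSq w - q₀) P := fun n =>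
    (Finset.aemeasurable_fun_sum _ fun i _ =>
      hmdsq.comp_aemeasurable (hlaw i).aemeasurable).fun_const_smul _
  have hmY : ∀ n : ℕ, AEMeasurable (fun ω => √n • (θhat n ω - K q₀)) P := fun n =>
    ((hmeas n).sub_const _).fun_const_smul _
  refine tendstoInDistribution_of_tendstoInMeasure_sub _ _ hclt ?_ hmY
  -- The first two terms bound the effect of the estimated centre and the Taylor remainder of `K`;
  -- the summand `1` keeps the comparison sequence positive.
  refine tendstoInMeasure_zero_of_isLittleO (B := fun n ω => √n * ‖avg n (fun i => Y i ω) dir‖ +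
    √n * ‖avg n (fun i => Y i ω) fun w => dirSq w - q₀‖ + 1) (fun n => ?_) (fun n => ?_) ?_ ?_ ?_
  · exact ((hmY n).sub (hclt.forall_aemeasurable n)).aestronglyMeasurable
  · exact ((((hmdir n).norm.const_mul _).add ((hmsq n).norm.const_mul _)).add_const
      1).aestronglyMeasurable
  · refine ((boundedInProb_sqrt_mul_avg hlaw hindep measurable_dir norm_dir_le ?_).add
      (boundedInProb_sqrt_mul_avg hlaw hindep hmdsq (K := 2) (fun w => ?_) ?_)).add
      (boundedInProb_const 1)
    · exact h.integral_odd _ fun z => by rw [dir, dir, norm_neg, neg_div]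
    · refine (norm_sub_le _ _).trans ?_
      linarith [norm_dirSq_le w, h.norm_lt_one]
    · rw [integral_sub (integrable_of_bound measurable_dirSq norm_dirSq_le) (integrable_const _),
        h.integral_dirSq]
      simp
  · intro n ω
    positivity
  · filter_upwards [h.ae_dirSqEst hlaw hindep ht, heq] with ω ⟨h1, h2, h3, _⟩ heq
    set y : ℕ → ℂ := fun i => Y i ω
    set b : ℕ → ℝ := fun n => ‖avg n y dir‖ + ‖avg n y fun w => dirSq w - q₀‖ with hb
    have havg : ∀ n ≠ 0, (avg n y fun w => dirSq w - q₀) = avg n y dirSq - q₀ := by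
      intro n hn
      have : (n : ℂ) ≠ 0 := by exact_mod_cast hn
      simp only [avg, Finset.sum_sub_distrib, smul_sub]
      simp [this]
    have hb1 : (fun n => avg n y dir) =O[atTop] b := by
      refine Asymptotics.IsBigO.of_bound 1 (Eventually.of_forall fun n => ?_)
      rw [one_mul, Real.norm_of_nonneg (by positivity)]
      exact le_add_of_nonneg_right (norm_nonneg _)
    have hb2 : (fun n => avg n y fun w => dirSq w - q₀) =O[atTop] b := by
      refine Asymptotics.IsBigO.of_bound 1 (Eventually.of_forall fun n => ?_)
      rw [one_mul, Real.norm_of_nonneg (by positivity)]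
      exact le_add_of_nonneg_left (norm_nonneg _)
    have hd : (fun n => dirSqEst n y (t n ω) - avg n y dirSq) =o[atTop] b := h1.trans_isBigO hb1
    have hqO : (fun n => dirSqEst n y (t n ω) - q₀) =O[atTop] b := by
      refine (hd.isBigO.add hb2).congr' ?_ EventuallyEq.rfl
      filter_upwards [eventually_ne_atTop 0] with n hn
      rw [havg n hn]; ring
    have hq : Tendsto (fun n => dirSqEst n y (t n ω)) atTop (𝓝 q₀) := by
      have := (h1.trans_tendsto h2).add h3
      simpa using this
    have hKo : (fun n => K (dirSqEst n y (t n ω)) - K q₀ - L (dirSqEst n y (t n ω) - q₀)) =o[atTop] b :=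
      (hK.isLittleO.comp_tendsto hq).trans_isBigO hqO
    have hLo : (fun n => L (dirSqEst n y (t n ω) - avg n y dirSq)) =o[atTop] b :=
      (L.isBigO_comp _ _).trans_isLittleO hd
    have htot : (fun n => (θhat n ω - K q₀) - L (avg n y fun w => dirSq w - q₀)) =o[atTop] b := by
      refine (hKo.add hLo).congr' ?_ EventuallyEq.rfl
      filter_upwards [eventually_ne_atTop 0, heq] with n hn he
      rw [havg n hn, he, map_sub, map_sub, map_sub]
      abel
    have hmul : (fun n : ℕ => √(n : ℝ) • ((θhat n ω - K q₀) - L (avg n y fun w => dirSq w - q₀)))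
        =o[atTop] fun n : ℕ => √(n : ℝ) • b n :=
      (Asymptotics.isBigO_refl (fun n : ℕ => √(n : ℝ)) atTop).smul_isLittleO htot
    refine (hmul.congr_left fun n => ?_).trans_isBigO (Asymptotics.IsBigO.of_bound 1
      (Eventually.of_forall fun n => ?_))
    · simp [smul_sub, y]
    · rw [one_mul, Real.norm_of_nonneg (by positivity), Real.norm_of_nonneg (by positivity),
        smul_eq_mul, hb, mul_add]
      linarith

end IsDirLaw

/-! ### Elliptical laws in complex coordinates -/

/-- The isometry `x ↦ x₀ + i x₁`. -/
def toComplex : Vec 2 ≃ₗᵢ[ℝ] ℂ := Complex.orthonormalBasisOneI.repr.symm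

theorem toComplex_re (x : Vec 2) : (toComplex x).re = x 0 := by
  simp [toComplex]

theorem toComplex_im (x : Vec 2) : (toComplex x).im = x 1 := by
  simp [toComplex]

/-- The quadratic form of `V⁻¹` in complex coordinates. -/
def quad (V : Matrix (Fin 2) (Fin 2) ℝ) (z : ℂ) : ℝ :=
  (V 1 1 * z.re ^ 2 - 2 * V 0 1 * z.re * z.im + V 0 0 * z.im ^ 2) / V.det

theorem measurable_quad (V : Matrix (Fin 2) (Fin 2) ℝ) : Measurable (quad V) := by
  unfold quad
  fun_prop

/-- The density of the centred elliptical law in complex coordinates. -/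
def centredDensity (V : Matrix (Fin 2) (Fin 2) ℝ) (g : ℝ → ℝ) (z : ℂ) : ℝ :=
  (√V.det)⁻¹ * g (quad V z)

/-- The centred elliptical law in complex coordinates. -/
def centredLaw (V : Matrix (Fin 2) (Fin 2) ℝ) (g : ℝ → ℝ) : Measure ℂ :=
  (volume : Measure ℂ).withDensity fun z => ENNReal.ofReal (centredDensity V g z)

theorem measurable_centredDensity (V : Matrix (Fin 2) (Fin 2) ℝ) {g : ℝ → ℝ} (hg : Measurable g) :
    Measurable (centredDensity V g) :=
  (hg.comp (measurable_quad V)).const_mul _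

theorem ellipticalDensity_eq {V : Matrix (Fin 2) (Fin 2) ℝ} (hV : V.PosDef) (μ : Vec 2) (g : ℝ → ℝ)
    (x : Vec 2) : ellipticalDensity μ V g x = centredDensity V g (toComplex (x - μ)) := by
  have hdet := hV.det_pos.ne'
  rw [ellipticalDensity, centredDensity, quad, toComplex_re, toComplex_im]
  congr 2
  rw [Matrix.inv_def, Matrix.adjugate_fin_two, Ring.inverse_eq_inv']
  simp [dotProduct, Fin.sum_univ_two, Matrix.mulVec, symm_of_posDef hV]
  field_simp
  ring

theorem map_withDensity_comp {α β : Type*} [MeasurableSpace α] [MeasurableSpace β]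
    {μ : Measure α} {ν : Measure β} {e : α → β} (he : MeasurePreserving e μ ν)
    {D : β → ENNReal} (hD : Measurable D) :
    (μ.withDensity fun x => D (e x)).map e = ν.withDensity D := by
  ext s hs
  rw [Measure.map_apply he.measurable hs, withDensity_apply _ (he.measurable hs),
    withDensity_apply _ hs, ← he.setLIntegral_comp_preimage hs hD]

theorem measurePreserving_toComplex_sub (μ : Vec 2) :
    MeasurePreserving (fun x : Vec 2 => toComplex (x - μ)) volume volume :=
  toComplex.measurePreserving.comp (measurePreserving_sub_right volume μ)

theorem IsElliptical.eq_withDensity_centredDensity {F : Measure (Vec 2)} {μ : Vec 2}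
    {V : Matrix (Fin 2) (Fin 2) ℝ} {g : ℝ → ℝ} (hF : IsElliptical F μ V g) :
    F = (volume : Measure (Vec 2)).withDensity
      fun x => ENNReal.ofReal (centredDensity V g (toComplex (x - μ))) := by
  refine hF.eq_withDensity.trans (congrArg _ (funext fun x => ?_))
  rw [ellipticalDensity_eq hF.posDef μ g]

theorem map_toComplex_sub {F : Measure (Vec 2)} {μ : Vec 2} {V : Matrix (Fin 2) (Fin 2) ℝ}
    {g : ℝ → ℝ} (hF : IsElliptical F μ V g) :
    F.map (fun x => toComplex (x - μ)) = centredLaw V g := by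
  rw [hF.eq_withDensity_centredDensity, centredLaw]
  exact map_withDensity_comp (e := fun x => toComplex (x - μ))
    (D := fun z => ENNReal.ofReal (centredDensity V g z)) (measurePreserving_toComplex_sub μ)
    (measurable_centredDensity V hF.measurable_generator).ennreal_ofReal

/-- The positive part is the one taken by `ENNReal.ofReal`; carrying it along avoids any discussion
of the sign of the density. -/
theorem integral_centredLaw {V : Matrix (Fin 2) (Fin 2) ℝ} {g : ℝ → ℝ} (hg : Measurable g)
    (f : ℂ → ℂ) :
    ∫ z, f z ∂centredLaw V g = ∫ z, ((max (centredDensity V g z) 0 : ℝ) : ℂ) * f z := by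
  rw [centredLaw, integral_withDensity_eq_integral_toReal_smul
    (measurable_centredDensity V hg).ennreal_ofReal (by simp)]
  simp [ENNReal.toReal_ofReal']

/-! #### The square root of the shape matrix -/

/-- The coefficient of `z` in the square root of `V`, as a real linear map on `ℂ`. -/
def rootCoeff (V : Matrix (Fin 2) (Fin 2) ℝ) : ℝ := √(V 0 0 + V 1 1 + 2 * √V.det) / 2

/-- The square root of `V` as a real linear map on `ℂ`. -/
def rootMap (V : Matrix (Fin 2) (Fin 2) ℝ) : ℂ →ₗ[ℝ] ℂ where
  toFun z := rootCoeff V * (z + meanDirSq V * conj z)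
  map_add' z w := by simp; ring
  map_smul' c z := by simp; ring

theorem rootMap_apply (V : Matrix (Fin 2) (Fin 2) ℝ) (z : ℂ) :
    rootMap V z = rootCoeff V * (z + meanDirSq V * conj z) := rfl

theorem rootCoeff_pos {V : Matrix (Fin 2) (Fin 2) ℝ} (hV : V.PosDef) : 0 < rootCoeff V :=
  div_pos (Real.sqrt_pos.2 (trace_add_pos hV)) two_pos

theorem rootCoeff_sq {V : Matrix (Fin 2) (Fin 2) ℝ} (hV : V.PosDef) :
    rootCoeff V ^ 2 = (V 0 0 + V 1 1 + 2 * √V.det) / 4 := by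
  rw [rootCoeff, div_pow, Real.sq_sqrt (trace_add_pos hV).le]
  norm_num

theorem det_rootMap {V : Matrix (Fin 2) (Fin 2) ℝ} (hV : V.PosDef) :
    LinearMap.det (rootMap V) = √V.det := by
  have h1 : LinearMap.det (rootMap V) = rootCoeff V ^ 2 * (1 - ‖meanDirSq V‖ ^ 2) := by
    rw [← LinearMap.det_toMatrix Complex.basisOneI, Matrix.det_fin_two,
      ← Complex.normSq_eq_norm_sq, Complex.normSq_apply]
    simp [LinearMap.toMatrix_apply, rootMap_apply]
    ring
  rw [h1, rootCoeff_sq hV, one_sub_norm_meanDirSq_sq hV]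
  have := trace_add_pos hV
  field_simp

/-- By Cayley–Hamilton the square root of `V` is `(V + √det V) / √(tr V + 2√det V)`, and `rootMap V`
is this matrix in complex coordinates. -/
theorem quad_rootMap {V : Matrix (Fin 2) (Fin 2) ℝ} (hV : V.PosDef) (z : ℂ) :
    quad V (rootMap V z) = ‖z‖ ^ 2 := by
  have hN := trace_add_pos hV
  have hc := rootCoeff_sq hV
  have hr : √V.det ^ 2 = V.det := Real.sq_sqrt hV.det_pos.le
  have hd := det_eq_of_posDef hV
  have hre : (rootMap V z).re = 2 * rootCoeff V / (V 0 0 + V 1 1 + 2 * √V.det) *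
      ((V 0 0 + √V.det) * z.re + V 0 1 * z.im) := by
    rw [rootMap_apply]
    simp [meanDirSq]
    field_simp
    ring
  have him : (rootMap V z).im = 2 * rootCoeff V / (V 0 0 + V 1 1 + 2 * √V.det) *
      (V 0 1 * z.re + (V 1 1 + √V.det) * z.im) := by
    rw [rootMap_apply]
    simp [meanDirSq]
    field_simp
    ring
  have hk : (2 * rootCoeff V / (V 0 0 + V 1 1 + 2 * √V.det)) ^ 2 *
      (V 0 0 + V 1 1 + 2 * √V.det) = 1 := by
    rw [div_pow, mul_pow, hc]
    field_simp
    norm_num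
  rw [← Complex.normSq_eq_norm_sq, Complex.normSq_apply, quad, div_eq_iff hV.det_pos.ne', hre, him]
  rw [hd] at hr ⊢
  rw [hd] at hk
  generalize √(V 0 0 * V 1 1 - V 0 1 ^ 2) = r at *
  generalize 2 * rootCoeff V / (V 0 0 + V 1 1 + 2 * r) = k at *
  linear_combination (k ^ 2 * (V 1 1 * z.re ^ 2 + V 0 0 * z.im ^ 2 - 2 * V 0 1 * z.re * z.im)) * hr +
    ((z.re ^ 2 + z.im ^ 2) * (V 0 0 * V 1 1 - V 0 1 ^ 2)) * hk

/-- Integrals of functions of the direction under the centred elliptical law. -/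
theorem integral_centredLaw_of_homogeneous {V : Matrix (Fin 2) (Fin 2) ℝ} (hV : V.PosDef) {g : ℝ → ℝ}
    (hg : Measurable g) {f : ℂ → ℂ} (hf : Measurable f)
    (hhom : ∀ (r : ℝ) (z : ℂ), 0 < r → f (r * z) = f z) :
    ∫ z, f z ∂centredLaw V g =
      (∫ r in Set.Ioi (0 : ℝ), ((r * max (g (r ^ 2)) 0 : ℝ) : ℂ)) *
        ∫ θ in Set.Ioo (-Real.pi) Real.pi, f (rootMap V (Complex.exp (θ * Complex.I))) := by
  have hr : 0 < √V.det := Real.sqrt_pos.2 hV.det_pos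
  have hdet : LinearMap.det (rootMap V) ≠ 0 := by rw [det_rootMap hV]; exact hr.ne'
  have hcont : Continuous (rootMap V) := LinearMap.continuous_of_finiteDimensional _
  have hmap := Measure.map_linearMap_addHaar_eq_smul_addHaar (volume : Measure ℂ) hdet
  rw [det_rootMap hV, abs_of_pos (inv_pos.2 hr)] at hmap
  have hm : Measurable fun z => ((max (centredDensity V g z) 0 : ℝ) : ℂ) * f z :=
    (Complex.measurable_ofReal.comp ((measurable_centredDensity V hg).max measurable_const)).mul hf
  -- Under the substitution by `rootMap V` the Jacobian `√det V` cancels the normalizing factor of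
  -- the density, leaving a radial weight.
  have h1 : ∫ z, ((max (centredDensity V g z) 0 : ℝ) : ℂ) * f z =
      ∫ z, ((max (g (‖z‖ ^ 2)) 0 : ℝ) : ℂ) * f (rootMap V z) := by
    have h2 := integral_map hcont.aemeasurable (μ := (volume : Measure ℂ))
      (f := fun z => ((max (centredDensity V g z) 0 : ℝ) : ℂ) * f z) hm.aestronglyMeasurable
    rw [hmap, integral_smul_measure, ENNReal.toReal_ofReal (inv_pos.2 hr).le] at h2
    have h3 : ∀ z, ((max (centredDensity V g (rootMap V z)) 0 : ℝ) : ℂ) * f (rootMap V z) =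
        ((√V.det)⁻¹ : ℝ) • (((max (g (‖z‖ ^ 2)) 0 : ℝ) : ℂ) * f (rootMap V z)) := by
      intro z
      rw [centredDensity, quad_rootMap hV, Complex.real_smul, ← mul_assoc, ← Complex.ofReal_mul,
        mul_max_of_nonneg _ _ (inv_pos.2 hr).le, mul_zero]
    simp_rw [h3] at h2
    rw [integral_smul] at h2
    exact smul_right_injective ℂ (inv_pos.2 hr).ne' h2
  rw [integral_centredLaw hg, h1, ← Complex.integral_comp_polarCoord_symm,
    ← setIntegral_prod_mul, ← Measure.volume_eq_prod]
  refine setIntegral_congr_fun polarCoord.open_target.measurableSet fun p hp => ?_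
  have hp1 : 0 < p.1 := hp.1
  have hpol : Complex.polarCoord.symm p = p.1 * Complex.exp (p.2 * Complex.I) := by
    rw [Complex.polarCoord_symm_apply, Complex.exp_mul_I, Complex.ofReal_cos, Complex.ofReal_sin]
  have hlin : rootMap V (p.1 * Complex.exp (p.2 * Complex.I)) =
      p.1 * rootMap V (Complex.exp (p.2 * Complex.I)) := by
    rw [← Complex.real_smul, map_smul, Complex.real_smul]
  have hnorm : ‖(p.1 : ℂ) * Complex.exp (p.2 * Complex.I)‖ = p.1 := by
    rw [norm_mul, Complex.norm_exp_ofReal_mul_I, mul_one, Complex.norm_real, Real.norm_eq_abs,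
      abs_of_pos hp1]
  simp only [hpol, hlin, hnorm]
  rw [hhom _ _ hp1, Complex.real_smul]
  push_cast
  ring

theorem isProbabilityMeasure_centredLaw {F : Measure (Vec 2)} {μ : Vec 2}
    {V : Matrix (Fin 2) (Fin 2) ℝ} {g : ℝ → ℝ} (hF : IsElliptical F μ V g) :
    IsProbabilityMeasure (centredLaw V g) := by
  have := hF.isProbabilityMeasure
  rw [← map_toComplex_sub hF]
  exact Measure.isProbabilityMeasure_map
    (measurePreserving_toComplex_sub μ).measurable.aemeasurable

/-- The mean of a function of the direction under the centred elliptical law. -/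
theorem integral_centredLaw_eq_average {V : Matrix (Fin 2) (Fin 2) ℝ} (hV : V.PosDef) {g : ℝ → ℝ}
    (hg : Measurable g) [IsProbabilityMeasure (centredLaw V g)] {f : ℂ → ℂ} (hf : Measurable f)
    (hhom : ∀ (r : ℝ) (z : ℂ), 0 < r → f (r * z) = f z) :
    ∫ z, f z ∂centredLaw V g =
      (2 * Real.pi)⁻¹ * ∫ θ in Set.Ioo (-Real.pi) Real.pi,
        f (rootMap V (Complex.exp (θ * Complex.I))) := by
  -- Taking `f = 1` identifies the radial integral as `1 / (2π)`, since the total mass is one.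
  have h1 := integral_centredLaw_of_homogeneous hV hg (f := fun _ => 1) measurable_const
    fun _ _ _ => rfl
  have h2 : (∫ r in Set.Ioi (0 : ℝ), ((r * max (g (r ^ 2)) 0 : ℝ) : ℂ)) * (2 * Real.pi) = 1 := by
    have h3 : ∫ _ in Set.Ioo (-Real.pi) Real.pi, (1 : ℂ) = 2 * Real.pi := by
      rw [setIntegral_const, Measure.real, Real.volume_Ioo,
        ENNReal.toReal_ofReal (by linarith [Real.pi_pos])]
      simp
      ring
    rw [h3] at h1
    rw [← h1]
    simp
  rw [integral_centredLaw_of_homogeneous hV hg hf hhom, eq_inv_of_mul_eq_one_left h2]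
  push_cast
  rfl

theorem dirSq_mul_of_pos {r : ℝ} (hr : 0 < r) (z : ℂ) : dirSq (r * z) = dirSq z := by
  have : (r : ℂ) ≠ 0 := by exact_mod_cast hr.ne'
  rw [dirSq, dirSq, map_mul, Complex.conj_ofReal, mul_div_mul_left _ _ this]

theorem one_add_ne_zero_of_norm_le {m z : ℂ} (hm : ‖m‖ < 1) (hz : ‖z‖ ≤ 1) :
    1 + conj m * z ^ 2 ≠ 0 := by
  refine one_add_ne_zero_of_norm_lt_one ?_
  rw [norm_mul, norm_pow, Complex.norm_conj]
  have := pow_le_one₀ (norm_nonneg z) hz (n := 2)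
  nlinarith [norm_nonneg m, norm_nonneg z]

/-- On the unit circle `conj z = 1 / z`, so expanding by `z` removes the conjugates of `z` and
leaves a Möbius transformation of the disc evaluated at `z²`. -/
theorem dirSq_rootMap_exp {V : Matrix (Fin 2) (Fin 2) ℝ} (hV : V.PosDef) (θ : ℝ) :
    dirSq (rootMap V (Complex.exp (θ * Complex.I))) =
      (fun z => (z ^ 2 + meanDirSq V) / (1 + conj (meanDirSq V) * z ^ 2)) (circleMap 0 1 θ) := by
  have hz : circleMap 0 1 θ = Complex.exp (θ * Complex.I) := by simp [circleMap]
  rw [rootMap_apply, dirSq_mul_of_pos (rootCoeff_pos hV), hz]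
  set z := Complex.exp (θ * Complex.I)
  have hnz : ‖z‖ = 1 := Complex.norm_exp_ofReal_mul_I θ
  have hzz : z * conj z = 1 := by rw [Complex.mul_conj', hnz]; simp
  have hz0 : z ≠ 0 := Complex.exp_ne_zero _
  have e1 : z ^ 2 + meanDirSq V = z * (z + meanDirSq V * conj z) := by
    linear_combination (-meanDirSq V) * hzz
  have e2 : 1 + conj (meanDirSq V) * z ^ 2 = z * (conj z + conj (meanDirSq V) * z) := by
    linear_combination -hzz
  simp only
  rw [e1, e2, mul_div_mul_left _ _ hz0, dirSq, map_add, map_mul, Complex.conj_conj]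

/-- Mean value property: the circle average of the holomorphic function `((z² + m) / (1 + conj m
z²))^k` is its value `m^k` at the origin. -/
theorem integral_dirSq_pow_centredLaw {V : Matrix (Fin 2) (Fin 2) ℝ} (hV : V.PosDef) {g : ℝ → ℝ}
    (hg : Measurable g) [IsProbabilityMeasure (centredLaw V g)] (k : ℕ) :
    ∫ z, dirSq z ^ k ∂centredLaw V g = meanDirSq V ^ k := by
  rw [integral_centredLaw_eq_average hV hg (measurable_dirSq.pow_const k)
    fun r z hr => by rw [dirSq_mul_of_pos hr]]
  have hlt := norm_meanDirSq_lt_one hV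
  set m := meanDirSq V with hm
  have hcl : DiffContOnCl ℂ (fun z : ℂ => ((z ^ 2 + m) / (1 + conj m * z ^ 2)) ^ k)
      (Metric.ball 0 |1|) := by
    refine DifferentiableOn.diffContOnCl fun z hz => ?_
    rw [abs_one, closure_ball _ one_ne_zero, mem_closedBall_zero_iff] at hz
    have := one_add_ne_zero_of_norm_le hlt hz
    refine DifferentiableAt.differentiableWithinAt ?_
    fun_prop (disch := assumption)
  have havg := hcl.circleAverage
  rw [Real.circleAverage_def] at havg
  simp only [ne_eq, OfNat.ofNat_ne_zero, not_false_eq_true, zero_pow, zero_add, mul_zero, add_zero,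
    div_one] at havg
  rw [← havg, Complex.real_smul]
  push_cast
  congr 1
  simp_rw [dirSq_rootMap_exp hV, ← hm]
  rw [← integral_Ioc_eq_integral_Ioo, ← intervalIntegral.integral_of_le (by linarith [Real.pi_pos])]
  have hper : Function.Periodic
      (fun θ : ℝ => ((circleMap 0 1 θ ^ 2 + m) / (1 + conj m * circleMap 0 1 θ ^ 2)) ^ k)
      (2 * Real.pi) := by
    intro θ
    simp only [periodic_circleMap 0 1 θ]
  have := hper.intervalIntegral_add_eq (-Real.pi) 0
  rw [zero_add, show -Real.pi + 2 * Real.pi = Real.pi by ring] at this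
  exact this

theorem integral_odd_centredLaw {V : Matrix (Fin 2) (Fin 2) ℝ} {g : ℝ → ℝ}
    (hg : Measurable g) (f : ℂ → ℂ) (hf : ∀ z, f (-z) = -f z) :
    ∫ z, f z ∂centredLaw V g = 0 := by
  rw [integral_centredLaw hg]
  have hsym : ∀ z, centredDensity V g (-z) = centredDensity V g z := by
    intro z
    simp [centredDensity, quad]
  have h := integral_neg_eq_self (fun z => ((max (centredDensity V g z) 0 : ℝ) : ℂ) * f z)
    (volume : Measure ℂ)
  simp_rw [hsym, hf, mul_neg, integral_neg] at h
  exact self_eq_neg.1 h.symm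

theorem ae_ne_zero_centredLaw (V : Matrix (Fin 2) (Fin 2) ℝ) (g : ℝ → ℝ) :
    ∀ᵐ z ∂centredLaw V g, z ≠ 0 := by
  have h : ∀ᵐ z ∂(volume : Measure ℂ), z ≠ 0 := by
    rw [ae_iff]
    simp
  exact (withDensity_absolutelyContinuous _ _).ae_le h

/-- Near the origin the density is bounded and `3/2` is less than the dimension two; away from it
the power is bounded. This is where the local boundedness of the density enters. -/
theorem integrable_rpow_centredLaw {V : Matrix (Fin 2) (Fin 2) ℝ} {g : ℝ → ℝ}
    (hg : Measurable g) [IsProbabilityMeasure (centredLaw V g)] {C : ℝ}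
    (hC : ∀ᶠ z in 𝓝 (0 : ℂ), centredDensity V g z ≤ C) :
    Integrable (fun z : ℂ => ‖z‖ ^ (-(3 / 2) : ℝ)) (centredLaw V g) := by
  obtain ⟨ε, hε, hball⟩ := Metric.eventually_nhds_iff_ball.1 hC
  have hmk := measurable_centredDensity V hg
  have hk : Integrable (fun z => max (centredDensity V g z) 0) (volume : Measure ℂ) := by
    have h1 : Integrable (fun _ : ℂ => (1 : ℝ)) (centredLaw V g) := integrable_const _
    rw [centredLaw, integrable_withDensity_iff_integrable_smul' hmk.ennreal_ofReal (by simp)] at h1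
    simpa [ENNReal.toReal_ofReal'] using h1
  rw [centredLaw, integrable_withDensity_iff_integrable_smul' hmk.ennreal_ofReal (by simp)]
  simp only [ENNReal.toReal_ofReal', smul_eq_mul]
  have hmeas : Measurable fun z : ℂ => max (centredDensity V g z) 0 * ‖z‖ ^ (-(3 / 2) : ℝ) :=
    (hmk.max measurable_const).mul (by fun_prop)
  rw [← integrableOn_univ, ← Set.union_compl_self (Metric.ball (0 : ℂ) ε)]
  refine IntegrableOn.union ?_ ?_
  · refine integrableOn_ball_of_norm_le_rpow (C := max C 0) (α := 3 / 2) ?_ ?_ ?_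
      hmeas.aestronglyMeasurable
    · rw [Complex.finrank_real_complex]; norm_num
    · rw [Complex.finrank_real_complex]; norm_num
    · refine (ae_restrict_iff' Metric.isOpen_ball.measurableSet).2 (ae_of_all _ fun z hz => ?_)
      rw [Real.norm_of_nonneg (by positivity)]
      exact mul_le_mul_of_nonneg_right (max_le_max_right 0 (hball z hz)) (by positivity)
  · refine Integrable.mono' ((hk.mul_const (ε ^ (-(3 / 2) : ℝ))).integrableOn)
      hmeas.aestronglyMeasurable ?_
    refine (ae_restrict_iff' Metric.isOpen_ball.measurableSet.compl).2 (ae_of_all _ fun z hz => ?_)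
    rw [Real.norm_of_nonneg (by positivity)]
    refine mul_le_mul_of_nonneg_left ?_ (le_max_right _ _)
    have hz' : ε ≤ ‖z‖ := by simpa using hz
    exact Real.rpow_le_rpow_of_nonpos hε hz' (by norm_num)

theorem isDirLaw_centredLaw {F : Measure (Vec 2)} {μ : Vec 2} {V : Matrix (Fin 2) (Fin 2) ℝ}
    {g : ℝ → ℝ} (hF : IsElliptical F μ V g)
    (hbdd : ∃ C : ℝ, ∀ᶠ x in 𝓝 μ, ellipticalDensity μ V g x ≤ C) :
    IsDirLaw (centredLaw V g) (meanDirSq V) := by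
  have hp := isProbabilityMeasure_centredLaw hF
  have hg := hF.measurable_generator
  obtain ⟨C, hC⟩ := hbdd
  refine ⟨hp, ae_ne_zero_centredLaw V g, integrable_rpow_centredLaw hg (C := C) ?_,
    integral_odd_centredLaw hg, ?_, integral_dirSq_pow_centredLaw hF.posDef hg 2,
    norm_meanDirSq_lt_one hF.posDef⟩
  · have hcont : Tendsto (fun z : ℂ => toComplex.symm z + μ) (𝓝 0) (𝓝 μ) := by
      have : Continuous fun z : ℂ => toComplex.symm z + μ :=
        toComplex.symm.continuous.add continuous_const
      simpa using this.tendsto 0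
    filter_upwards [hcont.eventually hC] with z hz
    rw [ellipticalDensity_eq hF.posDef, add_sub_cancel_right, LinearIsometryEquiv.apply_symm_apply] at hz
    exact hz
  · have := integral_dirSq_pow_centredLaw hF.posDef hg 1
    simpa using this

/-! ### The shape estimator in complex coordinates -/

/-- These are the double-angle formulas for `cos²`, `sin²` and `sin cos`. Writing `‖dirSq‖` in place
of `1` makes them valid at `x = 0` too. -/
theorem signOuter_eq (x : Vec 2) :
    signOuter x = !![(‖dirSq (toComplex x)‖ + (dirSq (toComplex x)).re) / 2,
        (dirSq (toComplex x)).im / 2;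
      (dirSq (toComplex x)).im / 2,
        (‖dirSq (toComplex x)‖ - (dirSq (toComplex x)).re) / 2] := by
  rcases eq_or_ne x 0 with rfl | hx
  · ext i j
    fin_cases i <;> fin_cases j <;>
      simp [signOuter, spatialSign, dirSq, Matrix.vecMulVec_apply]
  · have hw : toComplex x ≠ 0 := by simpa using hx
    have hn : ‖x‖ ≠ 0 := norm_ne_zero_iff.2 hx
    have hsq : ‖x‖ ^ 2 = x 0 ^ 2 + x 1 ^ 2 := by
      rw [EuclideanSpace.norm_sq_eq, Fin.sum_univ_two]
      simp
    have hd : dirSq (toComplex x) = ((‖x‖ ^ 2 : ℝ) : ℂ)⁻¹ * toComplex x ^ 2 := by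
      have h1 : toComplex x * conj (toComplex x) = ((‖x‖ ^ 2 : ℝ) : ℂ) := by
        rw [Complex.mul_conj', LinearIsometryEquiv.norm_map]
        push_cast
        rfl
      have hc : conj (toComplex x) ≠ 0 := by simpa using hx
      rw [← h1, dirSq]
      field_simp
    have hre : (dirSq (toComplex x)).re = (‖x‖ ^ 2)⁻¹ * (x 0 ^ 2 - x 1 ^ 2) := by
      rw [hd, ← Complex.ofReal_inv, Complex.re_ofReal_mul, sq (toComplex x), Complex.mul_re,
        toComplex_re, toComplex_im]
      ring
    have him : (dirSq (toComplex x)).im = (‖x‖ ^ 2)⁻¹ * (2 * x 0 * x 1) := by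
      rw [hd, ← Complex.ofReal_inv, Complex.im_ofReal_mul, sq (toComplex x), Complex.mul_im,
        toComplex_re, toComplex_im]
      ring
    have hone : (1 : ℝ) = (‖x‖ ^ 2)⁻¹ * (x 0 ^ 2 + x 1 ^ 2) := by
      rw [← hsq, inv_mul_cancel₀ (pow_ne_zero 2 hn)]
    rw [norm_dirSq hw, hre, him, hone]
    ext i j
    fin_cases i <;> fin_cases j <;>
      simp [signOuter, spatialSign, Matrix.vecMulVec_apply] <;> ring

theorem empSSCM_eq (n : ℕ) (x : ℕ → Vec 2) (t μ : Vec 2) {q : ℂ} {e : ℝ}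
    (hq : q = avg n (fun i => toComplex (x i - μ)) fun w => dirSq (w - toComplex (t - μ)))
    (he : e = avg n (fun i => toComplex (x i - μ)) fun w => ‖dirSq (w - toComplex (t - μ))‖) :
    empSSCM n x t = !![(e + q.re) / 2, q.im / 2; q.im / 2, (e - q.re) / 2] := by
  have hx : ∀ i, toComplex (x i - μ) - toComplex (t - μ) = toComplex (x i - t) := by
    intro i
    rw [← map_sub, sub_sub_sub_cancel_right]
  simp only [avg, hx] at hq he
  have hre : q.re = (n : ℝ)⁻¹ * ∑ i ∈ Finset.range n, (dirSq (toComplex (x i - t))).re := by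
    rw [hq, Complex.smul_re, Complex.re_sum, smul_eq_mul]
  have him : q.im = (n : ℝ)⁻¹ * ∑ i ∈ Finset.range n, (dirSq (toComplex (x i - t))).im := by
    rw [hq, Complex.smul_im, Complex.im_sum, smul_eq_mul]
  rw [smul_eq_mul] at he
  rw [hre, him, he, empSSCM]
  simp_rw [signOuter_eq]
  ext i j
  fin_cases i <;> fin_cases j <;>
    simp [Matrix.sum_apply, ← Finset.sum_div, Finset.sum_add_distrib, Finset.sum_sub_distrib] <;>
    ring

/-- As long as the normalized mean squared direction lies inside the unit disc, the shape estimator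
is a smooth function of it. -/
theorem shapeEst₀_eq {n : ℕ} {x : ℕ → Vec 2} {t μ : Vec 2}
    (he : 0 < avg n (fun i => toComplex (x i - μ)) fun w => ‖dirSq (w - toComplex (t - μ))‖)
    (hlt : ‖dirSqEst n (fun i => toComplex (x i - μ)) (toComplex (t - μ))‖ < 1) :
    shapeEst₀ n x t =
      shape₀ (dirSqToParam (dirSqEst n (fun i => toComplex (x i - μ)) (toComplex (t - μ))) 0)
        (dirSqToParam (dirSqEst n (fun i => toComplex (x i - μ)) (toComplex (t - μ))) 1) := by
  rw [shapeEst₀, shapeEst, shapeOfSSCM_eq, shape₀]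
  rw [dirSqEst, norm_div, Complex.norm_real, Real.norm_of_nonneg he.le, div_lt_one he] at hlt
  exact diagNormalize_shape_eq hlt (empSSCM_eq n x t μ rfl rfl)

theorem measurable_signOuter_apply (i j : Fin 2) : Measurable fun x : Vec 2 => signOuter x i j := by
  simp only [signOuter, spatialSign, Matrix.vecMulVec_apply, PiLp.smul_apply, smul_eq_mul]
  fun_prop

section

variable {Ω : Type*} [MeasurableSpace Ω] {P : Measure Ω}

theorem aemeasurable_empSSCM_apply {X : ℕ → Ω → Vec 2} (hX : ∀ i, AEMeasurable (X i) P) {m : Ω → Vec 2}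
    (hm : AEMeasurable m P) (n : ℕ) (i j : Fin 2) :
    AEMeasurable (fun ω => empSSCM n (fun k => X k ω) (m ω) i j) P := by
  simp only [empSSCM, Matrix.smul_apply, Matrix.sum_apply]
  exact (Finset.aemeasurable_fun_sum _ fun k _ =>
    (measurable_signOuter_apply i j).comp_aemeasurable ((hX k).sub hm)).fun_const_smul _

/-- Measurability is visible from `shapeOfSSCM_eq`; no measurable choice of eigenvectors is
involved. -/
theorem aemeasurable_shapeEst₀_apply {X : ℕ → Ω → Vec 2} (hX : ∀ i, AEMeasurable (X i) P)
    {m : Ω → Vec 2} (hm : AEMeasurable m P) (n : ℕ) (i j : Fin 2) :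
    AEMeasurable (fun ω => shapeEst₀ n (fun k => X k ω) (m ω) i j) P := by
  have h := aemeasurable_empSSCM_apply hX hm n
  simp only [shapeEst₀, shapeEst, shapeOfSSCM_eq, diagNormalize, Matrix.smul_apply, Matrix.mul_apply,
    Fin.sum_univ_two, Matrix.det_fin_two, smul_eq_mul]
  have h00 := h 0 0
  have h01 := h 0 1
  have h10 := h 1 0
  have h11 := h 1 1
  have hi0 := h i 0
  have hi1 := h i 1
  have h0j := h 0 j
  have h1j := h 1 j
  fun_prop

end

theorem sscm_eq {F : Measure (Vec 2)} {μ : Vec 2} {V : Matrix (Fin 2) (Fin 2) ℝ} {g : ℝ → ℝ}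
    (hF : IsElliptical F μ V g) (hν : IsDirLaw (centredLaw V g) (meanDirSq V)) :
    sscm F μ 0 0 = (1 + (meanDirSq V).re) / 2 ∧ sscm F μ 0 1 = (meanDirSq V).im / 2 := by
  have := hν.isProbabilityMeasure
  have hint : Integrable dirSq (centredLaw V g) :=
    IsDirLaw.integrable_of_bound measurable_dirSq norm_dirSq_le
  have hm : Measurable fun x => toComplex (x - μ) := (measurePreserving_toComplex_sub μ).measurable
  have htr : ∀ {f : ℂ → ℝ}, Measurable f →
      ∫ x, f (toComplex (x - μ)) ∂F = ∫ z, f z ∂centredLaw V g := by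
    intro f hf
    rw [← map_toComplex_sub hF, integral_map hm.aemeasurable hf.aestronglyMeasurable]
  have hre : ∫ z, (dirSq z).re ∂centredLaw V g = (meanDirSq V).re := by
    rw [← hν.integral_dirSq]
    exact integral_re hint
  have him : ∫ z, (dirSq z).im ∂centredLaw V g = (meanDirSq V).im := by
    rw [← hν.integral_dirSq]
    exact integral_im hint
  have hmre : Measurable fun z => (dirSq z).re := Complex.measurable_re.comp measurable_dirSq
  have hmim : Measurable fun z => (dirSq z).im := Complex.measurable_im.comp measurable_dirSq
  constructor
  · have h1 : sscm F μ 0 0 = ∫ z, (‖dirSq z‖ + (dirSq z).re) / 2 ∂centredLaw V g := by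
      rw [← htr (f := fun z => (‖dirSq z‖ + (dirSq z).re) / 2)
        ((measurable_dirSq.norm.add hmre).div_const 2)]
      simp [sscm, signOuter_eq]
    have hone : ∫ z, ‖dirSq z‖ ∂centredLaw V g = 1 := by
      rw [integral_congr_ae (hν.ae_ne_zero.mono fun z hz => norm_dirSq hz)]
      simp
    have hadd : ∫ z, (‖dirSq z‖ + (dirSq z).re) ∂centredLaw V g = 1 + (meanDirSq V).re := by
      rw [← hone, ← hre]
      exact integral_add hint.norm hint.re
    rw [h1, integral_div, hadd]
  · have h1 : sscm F μ 0 1 = ∫ z, (dirSq z).im / 2 ∂centredLaw V g := by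
      rw [← htr (f := fun z => (dirSq z).im / 2) (hmim.div_const 2)]
      simp [sscm, signOuter_eq]
    rw [h1, integral_div, him]

end SSCM

end

/-! ### Consistency and asymptotic normality of the shape estimator -/

theorem proposition5 {Ω : Type*} [MeasurableSpace Ω] (P : Measure Ω) [IsProbabilityMeasure P]
    (F : Measure (SSCM.Vec 2)) (μ : SSCM.Vec 2) (V : Matrix (Fin 2) (Fin 2) ℝ) (g : ℝ → ℝ)
    (hF : SSCM.IsElliptical F μ V g)
    (hbdd : ∃ C : ℝ, ∀ᶠ x in 𝓝 μ, SSCM.ellipticalDensity μ V g x ≤ C)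
    (U : Matrix (Fin 2) (Fin 2) ℝ) (l₁ l₂ : ℝ)
    (hU : U ∈ Matrix.orthogonalGroup (Fin 2) ℝ) (hl : l₂ ≤ l₁)
    (hV : V = U * Matrix.diagonal ![l₁, l₂] * U.transpose)
    (X : ℕ → Ω → SSCM.Vec 2) (hX_law : ∀ i, HasLaw (X i) F P) (hX_indep : iIndepFun X P)
    (μhat : ℕ → Ω → SSCM.Vec 2) (hμhat_meas : ∀ n, AEMeasurable (μhat n) P)
    (hμhat : ∀ n, ∀ᵐ ω ∂P, SSCM.IsSpatialMedian n (fun i => X i ω) (μhat n ω)) :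
    (∀ᵐ ω ∂P, Tendsto (fun n => SSCM.shapeEst₀ n (fun i => X i ω) (μhat n ω)) atTop
        (𝓝 (SSCM.shape₀ (SSCM.ratio V) (SSCM.corr V)))) ∧
    (SSCM.WV₀ (SSCM.ratio V) (SSCM.corr V) U l₁ l₂).PosSemidef ∧
    TendstoInDistribution
      (fun (n : ℕ) ω => Real.sqrt n •
        (!₂[SSCM.shapeEst₀ n (fun i => X i ω) (μhat n ω) 0 0,
            SSCM.shapeEst₀ n (fun i => X i ω) (μhat n ω) 0 1] -
          !₂[SSCM.ratio V, SSCM.corr V]))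
      atTop id (fun _ => P)
      (multivariateGaussian 0 (SSCM.WV₀ (SSCM.ratio V) (SSCM.corr V) U l₁ l₂)) ∧
    SSCM.paramToSSCM ![SSCM.ratio V, SSCM.corr V] = ![SSCM.sscm F μ 0 0, SSCM.sscm F μ 0 1] ∧
    ∃ D : Matrix (Fin 2) (Fin 2) ℝ,
      HasFDerivAt SSCM.paramToSSCM (LinearMap.toContinuousLinearMap (Matrix.toLin' D))
        ![SSCM.ratio V, SSCM.corr V] ∧
      (SSCM.G (SSCM.ratio V) (SSCM.corr V)).submatrix id (Fin.castLE (by norm_num : 2 ≤ 4)) * D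
        = 1 := by
  have hVp := hF.posDef
  have hν := SSCM.isDirLaw_centredLaw hF hbdd
  have hm : Measurable fun x => SSCM.toComplex (x - μ) :=
    (SSCM.measurePreserving_toComplex_sub μ).measurable
  have hXm : ∀ i, AEMeasurable (X i) P := fun i => (hX_law i).aemeasurable
  have hlaw : ∀ i, HasLaw (fun ω => SSCM.toComplex (X i ω - μ)) (SSCM.centredLaw V g) P := fun i =>
    HasLaw.comp (Y := fun x => SSCM.toComplex (x - μ))
      ⟨hm.aemeasurable, SSCM.map_toComplex_sub hF⟩ (hX_law i)
  have hindep : iIndepFun (fun i ω => SSCM.toComplex (X i ω - μ)) P :=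
    hX_indep.comp (fun _ x => SSCM.toComplex (x - μ)) fun _ => hm
  have ht : ∀ n, ∀ᵐ ω ∂P, ∀ u : ℂ,
      ∑ i ∈ Finset.range n, ‖SSCM.toComplex (X i ω - μ) - SSCM.toComplex (μhat n ω - μ)‖ ≤
        ∑ i ∈ Finset.range n, ‖SSCM.toComplex (X i ω - μ) - u‖ := by
    intro n
    filter_upwards [hμhat n] with ω hω u
    obtain ⟨v, rfl⟩ := SSCM.toComplex.surjective u
    have := hω (v + μ)
    simpa only [← map_sub, LinearIsometryEquiv.norm_map, sub_sub_sub_cancel_right,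
      sub_add_eq_sub_sub_swap] using this
  -- Almost surely the normalized mean is eventually inside the unit disc and the trace is positive,
  -- so from some `n` on the estimator equals the smooth function of `q` and its degenerate values
  -- play no role.
  have hconv : ∀ᵐ ω ∂P,
      Tendsto (fun n => SSCM.dirSqEst n (fun i => SSCM.toComplex (X i ω - μ))
        (SSCM.toComplex (μhat n ω - μ))) atTop (𝓝 (SSCM.meanDirSq V)) ∧
      ∀ᶠ n in atTop, SSCM.shapeEst₀ n (fun i => X i ω) (μhat n ω) =
        SSCM.shape₀
          (SSCM.dirSqToParam (SSCM.dirSqEst n (fun i => SSCM.toComplex (X i ω - μ))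
            (SSCM.toComplex (μhat n ω - μ))) 0)
          (SSCM.dirSqToParam (SSCM.dirSqEst n (fun i => SSCM.toComplex (X i ω - μ))
            (SSCM.toComplex (μhat n ω - μ))) 1) := by
    filter_upwards [hν.ae_dirSqEst hlaw hindep ht] with ω ⟨h1, h2, h3, h4⟩
    have hlim : Tendsto (fun n => SSCM.dirSqEst n (fun i => SSCM.toComplex (X i ω - μ))
        (SSCM.toComplex (μhat n ω - μ))) atTop (𝓝 (SSCM.meanDirSq V)) := by
      simpa using (h1.trans_tendsto h2).add h3
    refine ⟨hlim, ?_⟩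
    filter_upwards [h4.eventually_const_lt one_pos,
      hlim.norm.eventually_lt_const (SSCM.norm_meanDirSq_lt_one hVp)] with n he hlt
    exact SSCM.shapeEst₀_eq he hlt
  obtain ⟨L, hKL, hL⟩ := SSCM.hasFDerivAt_dirSqToParam hVp
  have hK := SSCM.dirSqToParam_meanDirSq hVp
  have ha := SSCM.ratio_pos hVp
  have hpsd := SSCM.WV₀_posSemidef hVp hU hV (SSCM.ratio V) (SSCM.corr V)
  refine ⟨?_, hpsd, ?_, ?_, SSCM.jacobian (SSCM.ratio V) (SSCM.corr V),
    SSCM.hasFDerivAt_paramToSSCM ha (SSCM.corr_sq_lt_one hVp),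
    SSCM.G₂_mul_jacobian ha (SSCM.corr_sq_lt_one hVp)⟩
  · filter_upwards [hconv] with ω ⟨hlim, heq⟩
    have hθ := hKL.continuousAt.tendsto.comp hlim
    rw [hK] at hθ
    have h0 := ((EuclideanSpace.proj (𝕜 := ℝ) (0 : Fin 2)).continuous.tendsto _).comp hθ
    have h1 := ((EuclideanSpace.proj (𝕜 := ℝ) (1 : Fin 2)).continuous.tendsto _).comp hθ
    refine Tendsto.congr' (heq.mono fun n hn => hn.symm) ?_
    refine tendsto_pi_nhds.2 fun i => tendsto_pi_nhds.2 fun j => ?_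
    fin_cases i <;> fin_cases j
    · exact h0
    · exact h1
    · exact h1
    · exact h0.inv₀ ha.ne'
  · rw [SSCM.WV₀_eq hVp hU hV] at hpsd ⊢
    rw [← hK]
    refine hν.tendstoInDistribution_of_eventually_eq hlaw hindep ht
      (SSCM.G₂ (SSCM.ratio V) (SSCM.corr V)) hKL hL hpsd (fun n => ?_) ?_
    · have h0 := SSCM.aemeasurable_shapeEst₀_apply hXm (hμhat_meas n) n 0 0
      have h1 := SSCM.aemeasurable_shapeEst₀_apply hXm (hμhat_meas n) n 0 1
      refine (WithLp.measurable_toLp 2 _).comp_aemeasurable (aemeasurable_pi_lambda _ fun i => ?_)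
      fin_cases i
      · exact h0
      · exact h1
    · filter_upwards [hconv] with ω ⟨_, heq⟩
      filter_upwards [heq] with n hn
      rw [hn]
      ext i
      fin_cases i <;> rfl
  · obtain ⟨h0, h1⟩ := SSCM.sscm_eq hF hν
    rw [SSCM.paramToSSCM_ratio_corr hVp, h0, h1]
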